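/- Let $k$ be a complete valuation field, i.e. a field with a multiplicative ultrametric absolute value $|\cdot|\colon k\to\mathbb R_{\ge 0}$ (possibly trivial) for which $k$ is complete, and let $O_k=\{c\in k : |c|\le 1\}$. A Banach $k$-vector space is a $k$-vector space $V$ which is complete for an ultrametric norm $\|\cdot\|$ satisfying $\|cv\|=|c|\,\|v\|$ for all $c\in k$, $v\in V$. For $S\subset V$ let $\langle S\rangle$ be the closure of the $k$-linear span of $S$, and let $\mathrm{rank}(V)$ be the least cardinality of a subset $S\subset V$ with $\langle S\rangle=V$. For a set $E$, let $C_0(E,k)$ be the set of maps $c\colon E\to k$ such that $\{e\in E : |c(e)|\ge\epsilon\}$ is finite for every $\epsilon>0$, with the norm $\|c\|=\sup_{e\in E}|c(e)|$ (which is $0$ if $E=\emptyset$). A subset $E\subset V$ is an orthonormal Schauder basis of $V$ if (1) $\|e\|=1$ for every $e\in E$; (2) $\bigl\|\sum_{e\in E}c(e)e\bigr\|=\|c\|$ for every $c\in C_0(E,k)$; and (3) every $v\in V$ is of the form $\sum_{e\in E}c(e)e$ for some $c\in C_0(E,k)$. The space $V$ is free if it admits an orthonormal Schauder basis, and is almost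 free if $\langle S\rangle$ (with the restricted norm) is free for every $S\subset V$ with $\#S<\mathrm{rank}(V)$. A filter (always assumed proper) is $\lambda$-complete, for a cardinal $\lambda$, if it is closed under intersections of non-empty families of fewer than $\lambda$ of its members. A cardinal $\kappa$ is $\lambda$-strongly compact if $\kappa\ge\lambda$ and every $\kappa$-complete filter on $\kappa$ is contained in a $\lambda$-complete ultrafilter on $\kappa$. Let $\lambda_k$ be the successor cardinal of $\max\{\#(k/O_k),\aleph_0\}$, where $k/O_k$ is the quotient of additive groups. **Theorem.** Let $V$ be a Banach $k$-vector space with $\#V=\mathrm{rank}(V)$, and suppose that $\mathrm{rank}(V)$ is $\lambda_k$-strongly compact. Then $V$ is free if and only if $V$ is almost free. -/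

import Mathlib

/-
A complete valuation field `k` is a complete ultrametric `NormedField` (the trivial valuation is
allowed), and a Banach `k`-vector space is a complete ultrametric normed `k`-vector space.
-/

open Filter Topology Cardinal

universe u v w

namespace UltraBanach

/-- The valuation ring `O_k = {c | |c| ≤ 1}`, as an additive subgroup of `k`. -/
def integers (k : Type u) [NormedField k] [IsUltrametricDist k] : AddSubgroup k where
  carrier := {c | ‖c‖ ≤ 1}
  zero_mem' := by simp
  add_mem' := fun {a b} ha hb =>
    (IsUltrametricDist.norm_add_le_max a b).trans (max_le ha hb)
  neg_mem' := fun {a} ha => by simpa using ha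

/-- `λ_k`, the successor cardinal of `max {#(k / O_k), ℵ₀}`; here `k / O_k` is the quotient of
additive groups (not the residue field). -/
noncomputable def lambdaCard (k : Type u) [NormedField k] [IsUltrametricDist k] : Cardinal.{u} :=
  Order.succ (max #(k ⧸ integers k) ℵ₀)

/-- `κ` is `lam`-strongly compact: `lam ≤ κ`, and every `κ`-complete (proper) filter on a set of
cardinality `κ` is contained in a `lam`-complete ultrafilter. `CardinalInterFilter F c` says that
`F` is closed under intersections of fewer than `c` members. -/
def IsStronglyCompactCard (lam κ : Cardinal.{w}) : Prop :=
  lam ≤ κ ∧ ∀ (X : Type w), #X = κ → ∀ F : Filter X, F.NeBot → CardinalInterFilter F κ →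
    ∃ U : Ultrafilter X, CardinalInterFilter (U : Filter X) lam ∧ (U : Filter X) ≤ F

section Spaces

variable (k : Type u) [NormedField k] (V : Type v) [NormedAddCommGroup V] [NormedSpace k V]

/-- `⟨S⟩`, the closure of the linear subspace generated by `S`. -/
def closedSpan {k : Type u} [NormedField k] {V : Type v} [NormedAddCommGroup V]
    [NormedSpace k V] (S : Set V) : Submodule k V :=
  (Submodule.span k S).topologicalClosure

/-- `rank V`, the least cardinality of a subset of `V` topologically generating `V`. -/
noncomputable def rank : Cardinal.{v} :=
  sInf {c : Cardinal.{v} | ∃ S : Set V, closedSpan (k := k) S = ⊤ ∧ #S = c}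

variable {V} in
/-- `E` is an orthonormal Schauder basis of `V`. The elements of `C₀(E, k)` are the families
`c : E → k` tending to `0` along the cofinite filter, and the norm of `c` is `⨆ e, ‖c e‖`. -/
structure IsOrthonormalSchauderBasis (E : Set V) : Prop where
  norm_eq_one : ∀ e ∈ E, ‖e‖ = 1
  norm_sum : ∀ c : E → k, Tendsto c cofinite (𝓝 0) →
    ∃ s : V, HasSum (fun e : E => c e • (e : V)) s ∧ ‖s‖ = ⨆ e : E, ‖c e‖
  exists_sum : ∀ x : V, ∃ c : E → k, Tendsto c cofinite (𝓝 0) ∧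
    HasSum (fun e : E => c e • (e : V)) x

/-- `V` is free: it admits an orthonormal Schauder basis. -/
def IsFree : Prop :=
  ∃ E : Set V, IsOrthonormalSchauderBasis k E

/-- `V` is `κ`-free: `⟨S⟩` is free for every subset `S` of `V` of cardinality `< κ`. -/
def IsCardFree (κ : Cardinal.{v}) : Prop :=
  ∀ S : Set V, #S < κ → IsFree k (closedSpan (k := k) S)

/-- `V` is almost free: it is `rank V`-free. -/
def IsAlmostFree : Prop :=
  IsCardFree k V (rank k V)

end Spaces

end UltraBanach

/-! In an ultrametric space, unit vectors each at distance at least one from the span of the others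
behave like an orthonormal basis, so freeness means that such a set has dense span (`isFree_iff`).
If all scalars have absolute value at most one, this says only that every nonzero vector has norm
one, which one-point sets detect.

Otherwise the main tool is a relative Gruson theorem (`IsCoordSystem.exists_extend`): if B/A embeds
isometrically into some C₀(I, k), with distances to A attained, an orthonormal basis of A extends to
one of B. So embeddings suffice in place of bases, and closed subspaces of free spaces are free,
which gives one direction.

For the converse let κ be the rank. If κ is regular, well-order V in type κ; the closed spans of
proper initial segments are free. Along a λ_k-complete ultrafilter refining the cocardinal filter
every k-valued function converges, and limits of coordinates embed V into C₀ of an ultraproduct of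
index sets (`exists_isCoordSystem_of_ultrafilter`).

If κ is singular, Shelah's singular compactness applies. Sets of size ν < κ enlarge to orthonormal
sets of size ν over which all extensions of size ν stay embeddable into free spaces
(`exists_saturated_superset`, `IsSaturated.exists_extend`). Countably many interleaved enlargements,
carried out along a cofinal set of fewer than κ indices, make these bases compatible, and
`exists_orthonormal_of_filtration` glues them. -/

namespace UltraBanach

/-! ### Closed spans and orthonormal sets -/

section Basics

variable {k : Type u} [NormedField k] {V : Type v} [NormedAddCommGroup V] [NormedSpace k V]

theorem subset_closedSpan (S : Set V) : S ⊆ closedSpan (k := k) S := fun _ hx =>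
  Submodule.le_topologicalClosure _ (Submodule.subset_span hx)

theorem isClosed_closedSpan (S : Set V) : IsClosed (closedSpan (k := k) S : Set V) :=
  Submodule.isClosed_topologicalClosure _

theorem span_le_closedSpan (S : Set V) : Submodule.span k S ≤ closedSpan (k := k) S :=
  Submodule.le_topologicalClosure _

theorem closedSpan_le {S : Set V} {A : Submodule k V} (hA : IsClosed (A : Set V)) (h : S ⊆ A) :
    closedSpan (k := k) S ≤ A :=
  Submodule.topologicalClosure_minimal _ (Submodule.span_le.2 h) hA

theorem closedSpan_le_closedSpan {S T : Set V} (h : S ⊆ closedSpan (k := k) T) :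
    closedSpan (k := k) S ≤ closedSpan (k := k) T :=
  closedSpan_le (isClosed_closedSpan T) h

theorem closedSpan_mono {S T : Set V} (h : S ⊆ T) :
    closedSpan (k := k) S ≤ closedSpan (k := k) T :=
  closedSpan_le_closedSpan (h.trans (subset_closedSpan T))

theorem mem_closedSpan_iff {S : Set V} {x : V} :
    x ∈ closedSpan (k := k) S ↔ ∀ ε > 0, ∃ y ∈ Submodule.span k S, ‖x - y‖ < ε := by
  rw [closedSpan, ← SetLike.mem_coe, Submodule.topologicalClosure_coe, Metric.mem_closure_iff]
  simp only [dist_eq_norm, SetLike.mem_coe]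

/-- An element of a closed span lies in the closed span of countably many generators. -/
theorem exists_countable_mem_closedSpan {S : Set V} {x : V} (hx : x ∈ closedSpan (k := k) S) :
    ∃ C ⊆ S, C.Countable ∧ x ∈ closedSpan (k := k) C := by
  rw [mem_closedSpan_iff] at hx
  have h : ∀ n : ℕ, ∃ F : Finset V, (F : Set V) ⊆ S ∧
      ∃ y ∈ Submodule.span k (F : Set V), ‖x - y‖ < 1 / ((n : ℝ) + 1) := by
    intro n
    obtain ⟨y, hy, hxy⟩ := hx _ (Nat.one_div_pos_of_nat (α := ℝ) (n := n))
    obtain ⟨F, hF, hyF⟩ := Submodule.mem_span_finite_of_mem_span hy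
    exact ⟨F, hF, y, hyF, hxy⟩
  choose F hFS y hy hxy using h
  refine ⟨⋃ n, (F n : Set V), Set.iUnion_subset hFS,
    Set.countable_iUnion fun n => (F n).countable_toSet, mem_closedSpan_iff.2 fun ε hε => ?_⟩
  obtain ⟨n, hn⟩ := exists_nat_one_div_lt hε
  exact ⟨y n, Submodule.span_mono (Set.subset_iUnion (fun n => (F n : Set V)) n) (hy n),
    (hxy n).trans hn⟩

theorem hasSum_piSingle_smul {T : Set V} [DecidableEq T] {t : V} (ht : t ∈ T) :
    HasSum (fun i : T => (Pi.single (⟨t, ht⟩ : T) (1 : k) : T → k) i • (i : V)) t := by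
  convert hasSum_single
    (f := fun i : T => (Pi.single (⟨t, ht⟩ : T) (1 : k) : T → k) i • (i : V)) ⟨t, ht⟩ ?_ using 1
  · simp
  · intro i hi
    rw [Pi.single_eq_of_ne hi, zero_smul]

variable (k) in
/-- A set of vectors of norm one, each of which is at distance one from the span of the others. -/
def IsOrthonormalSet (T : Set V) : Prop :=
  ∀ e ∈ T, ‖e‖ = 1 ∧ ∀ y ∈ Submodule.span k (T \ {e}), 1 ≤ ‖e + y‖

theorem isOrthonormalSet_empty : IsOrthonormalSet k (∅ : Set V) := fun _ h => h.elim

theorem IsOrthonormalSet.mono {T T' : Set V} (hT : IsOrthonormalSet k T) (h : T' ⊆ T) :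
    IsOrthonormalSet k T' := fun e he =>
  ⟨(hT e (h he)).1, fun y hy =>
    (hT e (h he)).2 y (Submodule.span_mono (Set.sdiff_subset_sdiff_left h) hy)⟩

theorem IsOrthonormalSet.norm_le {T : Set V} (hT : IsOrthonormalSet k T) {e : V} (he : e ∈ T)
    (c : k) {y : V} (hy : y ∈ Submodule.span k (T \ {e})) : ‖c‖ ≤ ‖c • e + y‖ := by
  by_cases hc : c = 0
  · simp [hc]
  have h := (hT e he).2 (c⁻¹ • y) (Submodule.smul_mem _ _ hy)
  have : c • e + y = c • (e + c⁻¹ • y) := by rw [smul_add, smul_inv_smul₀ hc]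
  rw [this, norm_smul]
  exact le_mul_of_one_le_right (norm_nonneg _) h

theorem IsOrthonormalSet.norm_le_sum {T : Set V} (hT : IsOrthonormalSet k T) (c : T → k)
    (F : Finset T) {e : T} (he : e ∈ F) : ‖c e‖ ≤ ‖∑ i ∈ F, c i • (i : V)‖ := by
  classical
  rw [← Finset.add_sum_erase F _ he]
  refine hT.norm_le e.2 _ (Submodule.sum_mem _ fun i hi => Submodule.smul_mem _ _ ?_)
  refine Submodule.subset_span ⟨i.2, ?_⟩
  simpa [Subtype.coe_inj] using (Finset.mem_erase.1 hi).1

theorem IsOrthonormalSet.norm_le_hasSum {T : Set V} (hT : IsOrthonormalSet k T) {c : T → k}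
    {x : V} (hx : HasSum (fun e : T => c e • (e : V)) x) (e : T) : ‖c e‖ ≤ ‖x‖ := by
  refine ge_of_tendsto hx.norm ?_
  filter_upwards [eventually_ge_atTop {e}] with F hF
  exact hT.norm_le_sum c F (hF (Finset.mem_singleton_self e))

/-- A vector of a span involves finitely many generators, and these all lie in one member of the
directed family. -/
theorem isOrthonormalSet_sUnion {C : Set (Set V)} (hC : DirectedOn (· ⊆ ·) C)
    (h : ∀ T ∈ C, IsOrthonormalSet k T) : IsOrthonormalSet k (⋃₀ C) := by
  rintro e ⟨T, hTC, he⟩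
  refine ⟨(h T hTC e he).1, fun y hy => ?_⟩
  obtain ⟨F, hF, hyF⟩ := Submodule.mem_span_finite_of_mem_span hy
  obtain ⟨T', hT', hFT'⟩ := hC.exists_mem_subset_of_finset_subset_biUnion (f := id) (s := F)
    ⟨T, hTC⟩ (by
      intro z hz
      obtain ⟨T', hT', hz'⟩ := (hF hz).1
      exact Set.mem_biUnion hT' hz')
  obtain ⟨T'', hT'', h1, h2⟩ := hC T hTC T' hT'
  refine ((h T'' hT'') e (h1 he)).2 y (Submodule.span_mono ?_ hyF)
  exact fun z hz => ⟨h2 (hFT' hz), (hF hz).2⟩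

variable [IsUltrametricDist V]

theorem norm_add_le_of_le {x y : V} {r : ℝ} (hx : ‖x‖ ≤ r) (hy : ‖y‖ ≤ r) : ‖x + y‖ ≤ r :=
  (IsUltrametricDist.norm_add_le_max x y).trans (max_le hx hy)

theorem norm_sub_le_of_le {x y : V} {r : ℝ} (hx : ‖x‖ ≤ r) (hy : ‖y‖ ≤ r) : ‖x - y‖ ≤ r :=
  by rw [sub_eq_add_neg]; exact norm_add_le_of_le hx (by rwa [norm_neg])

theorem norm_le_of_hasSum {I : Type w} {f : I → V} {x : V} (hx : HasSum f x) {r : ℝ} (hr : 0 ≤ r)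
    (h : ∀ i, ‖f i‖ ≤ r) : ‖x‖ ≤ r :=
  le_of_tendsto hx.norm (Eventually.of_forall fun _ =>
    IsUltrametricDist.norm_sum_le_of_forall_le_of_nonneg hr fun i _ => h i)

/-- The union of two mutually orthogonal orthonormal sets is orthonormal. -/
theorem IsOrthonormalSet.union {T T' : Set V} (hT : IsOrthonormalSet k T)
    (hT' : IsOrthonormalSet k T')
    (h : ∀ y ∈ Submodule.span k T, ∀ z ∈ Submodule.span k T', ‖z‖ ≤ ‖y + z‖) :
    IsOrthonormalSet k (T ∪ T') := by
  have h' : ∀ y ∈ Submodule.span k T, ∀ z ∈ Submodule.span k T', ‖y‖ ≤ ‖y + z‖ := by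
    intro y hy z hz
    simpa using norm_sub_le_of_le le_rfl (h y hy z hz)
  have hsplit : ∀ e y : V, y ∈ Submodule.span k ((T ∪ T') \ {e}) →
      ∃ y₁ ∈ Submodule.span k (T \ {e}), ∃ y₂ ∈ Submodule.span k (T' \ {e}), y₁ + y₂ = y := by
    intro e y hy
    rw [Set.union_sdiff_distrib, Submodule.span_union] at hy
    exact Submodule.mem_sup.1 hy
  rintro e (he | he)
  · refine ⟨(hT e he).1, fun y hy => ?_⟩
    obtain ⟨y₁, h₁, y₂, h₂, rfl⟩ := hsplit e y hy
    have h₁' := Submodule.span_mono Set.sdiff_subset h₁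
    have h₂' := Submodule.span_mono Set.sdiff_subset h₂
    rw [← add_assoc]
    exact ((hT e he).2 y₁ h₁).trans
      (h' _ (Submodule.add_mem _ (Submodule.subset_span he) h₁') _ h₂')
  · refine ⟨(hT' e he).1, fun y hy => ?_⟩
    obtain ⟨y₁, h₁, y₂, h₂, rfl⟩ := hsplit e y hy
    have h₁' := Submodule.span_mono Set.sdiff_subset h₁
    have h₂' := Submodule.span_mono Set.sdiff_subset h₂
    rw [add_left_comm]
    exact ((hT' e he).2 y₂ h₂).trans
      (h _ h₁' _ (Submodule.add_mem _ (Submodule.subset_span he) h₂'))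

/-- Disjoint parts of an orthonormal set are mutually orthogonal. -/
theorem IsOrthonormalSet.norm_le_add {T T₁ T₂ : Set V} (hT : IsOrthonormalSet k T) (h₁ : T₁ ⊆ T)
    (h₂ : T₂ ⊆ T) (hd : Disjoint T₁ T₂) {y z : V} (hy : y ∈ closedSpan (k := k) T₁)
    (hz : z ∈ Submodule.span k T₂) : ‖z‖ ≤ ‖y + z‖ := by
  -- Each coefficient of z is bounded by the norm of y + z, since the other terms lie in the span of
  -- the other vectors. The inequality is closed in y, so it passes to the closure.
  have key : ∀ y ∈ Submodule.span k T₁, ‖z‖ ≤ ‖y + z‖ := by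
    classical
    intro y hy
    obtain ⟨l, hl, rfl⟩ := Submodule.mem_span_set.1 hz
    refine IsUltrametricDist.norm_sum_le_of_forall_le_of_nonneg (norm_nonneg _) fun e he => ?_
    have heT : e ∈ T₂ := hl he
    rw [norm_smul, (hT e (h₂ heT)).1, mul_one, Finsupp.sum, ← Finset.add_sum_erase _ _ he,
      add_left_comm]
    refine hT.norm_le (h₂ heT) _ (Submodule.add_mem _ ?_ (Submodule.sum_mem _ fun i hi =>
      Submodule.smul_mem _ _ (Submodule.subset_span ?_)))
    · have hsub : T₁ ⊆ T \ {e} :=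
        fun t ht => ⟨h₁ ht, fun hte => hd.notMem_of_mem_left ht (hte ▸ heT)⟩
      exact Submodule.span_mono hsub hy
    · exact ⟨h₂ (hl (Finset.mem_of_mem_erase hi)), Finset.ne_of_mem_erase hi⟩
  have hcl : IsClosed {y : V | ‖z‖ ≤ ‖y + z‖} :=
    isClosed_le continuous_const (continuous_norm.comp (continuous_id.add continuous_const))
  rw [closedSpan, ← SetLike.mem_coe, Submodule.topologicalClosure_coe] at hy
  exact closure_minimal (fun y hy => key y hy) hcl hy

variable [CompleteSpace V]

theorem IsOrthonormalSet.summable {T : Set V} (hT : IsOrthonormalSet k T) {c : T → k}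
    (hc : Tendsto c cofinite (𝓝 0)) : Summable (fun e : T => c e • (e : V)) := by
  refine NonarchimedeanAddGroup.summable_of_tendsto_cofinite_zero ?_
  rw [tendsto_zero_iff_norm_tendsto_zero] at hc ⊢
  refine hc.congr fun e => ?_
  rw [norm_smul, (hT e e.2).1, mul_one]

/-- Vectors in the closed span of an orthonormal set have an expansion with coefficients tending
to zero. -/
theorem IsOrthonormalSet.exists_hasSum [CompleteSpace k] {T : Set V} (hT : IsOrthonormalSet k T)
    {x : V} (hx : x ∈ closedSpan (k := k) T) :
    ∃ c : T → k, Tendsto c cofinite (𝓝 0) ∧ HasSum (fun e : T => c e • (e : V)) x := by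
  classical
  have hfin : ∀ y ∈ Submodule.span k T, ∃ c : T → k, Tendsto c cofinite (𝓝 0) ∧
      HasSum (fun e : T => c e • (e : V)) y := by
    intro y hy
    induction hy using Submodule.span_induction with
    | mem y hy =>
      refine ⟨Pi.single ⟨y, hy⟩ 1, ?_, ?_⟩
      · refine tendsto_nhds_of_eventually_eq ?_
        filter_upwards [(Set.finite_singleton (⟨y, hy⟩ : T)).compl_mem_cofinite] with e he
        exact Pi.single_eq_of_ne he _
      · exact hasSum_piSingle_smul hy
    | zero => exact ⟨0, tendsto_const_nhds, by simp⟩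
    | add y z _ _ h₁ h₂ =>
      obtain ⟨c, hc, hcy⟩ := h₁
      obtain ⟨d, hd, hdz⟩ := h₂
      refine ⟨c + d, add_zero (0 : k) ▸ hc.add hd, ?_⟩
      simpa only [Pi.add_apply, add_smul] using hcy.add hdz
    | smul a y _ h =>
      obtain ⟨c, hc, hcy⟩ := h
      refine ⟨a • c, smul_zero (A := k) a ▸ hc.const_smul a, ?_⟩
      simpa only [Pi.smul_apply, smul_eq_mul, mul_smul] using hcy.const_smul a
  have hx' := mem_closedSpan_iff.1 hx
  have happ : ∀ n : ℕ, ∃ y : V, ‖x - y‖ < 1 / ((n : ℝ) + 1) ∧ ∃ c : T → k,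
      Tendsto c cofinite (𝓝 0) ∧ HasSum (fun e : T => c e • (e : V)) y := fun n => by
    obtain ⟨y, hy, hxy⟩ := hx' _ (Nat.one_div_pos_of_nat (α := ℝ) (n := n))
    exact ⟨y, hxy, hfin y hy⟩
  choose y hxy c hc hcy using happ
  -- Coefficients are 1-Lipschitz in the vector, so those of the approximations converge uniformly
  -- in e.
  have hdiff : ∀ n m e, ‖c n e - c m e‖ ≤ ‖y n - y m‖ := by
    intro n m e
    refine hT.norm_le_hasSum (c := fun e => c n e - c m e) ?_ e
    simpa only [sub_smul] using (hcy n).sub (hcy m)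
  have hyy : ∀ N n m, N ≤ n → N ≤ m → ‖y n - y m‖ ≤ 1 / ((N : ℝ) + 1) := by
    intro N n m hn hm
    rw [← sub_sub_sub_cancel_left _ _ x]
    exact norm_sub_le_of_le ((hxy m).le.trans (Nat.one_div_le_one_div hm))
      ((hxy n).le.trans (Nat.one_div_le_one_div hn))
  have hlim : ∀ e, ∃ a : k, Tendsto (fun n => c n e) atTop (𝓝 a) := by
    intro e
    refine cauchySeq_tendsto_of_complete (Metric.cauchySeq_iff.2 fun ε hε => ?_)
    obtain ⟨N, hN⟩ := exists_nat_one_div_lt hε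
    refine ⟨N, fun m hm n hn => ?_⟩
    rw [dist_eq_norm]
    exact ((hdiff m n e).trans (hyy N m n hm hn)).trans_lt hN
  choose a ha using hlim
  have hca : ∀ N e, ‖c N e - a e‖ ≤ 1 / ((N : ℝ) + 1) := by
    intro N e
    refine le_of_tendsto ((tendsto_const_nhds.sub (ha e)).norm) ?_
    filter_upwards [eventually_ge_atTop N] with n hn
    exact (hdiff N n e).trans (hyy N N n le_rfl hn)
  have ha0 : Tendsto a cofinite (𝓝 0) := by
    rw [Metric.tendsto_nhds]
    intro ε hε
    obtain ⟨N, hN⟩ := exists_nat_one_div_lt (half_pos hε)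
    filter_upwards [(Metric.tendsto_nhds.1 (hc N)) (ε / 2) (half_pos hε)] with e he
    rw [dist_zero_right] at he ⊢
    calc ‖a e‖ = ‖c N e - (c N e - a e)‖ := by rw [sub_sub_cancel]
      _ ≤ ‖c N e‖ + ‖c N e - a e‖ := norm_sub_le _ _
      _ < ε := by linarith [hca N e]
  refine ⟨a, ha0, ?_⟩
  obtain ⟨s, hs⟩ := hT.summable ha0
  suffices s = x by rwa [← this]
  refine eq_of_forall_dist_le fun ε hε => ?_
  obtain ⟨N, hN⟩ := exists_nat_one_div_lt hε
  rw [dist_eq_norm, ← sub_sub_sub_cancel_right s x (y N)]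
  refine norm_sub_le_of_le ?_ ((hxy N).le.trans hN.le)
  have h := (hs.sub (hcy N))
  refine (norm_le_of_hasSum h (by positivity) fun e => ?_).trans hN.le
  rw [← sub_smul, norm_smul, (hT e e.2).1, mul_one, norm_sub_rev]
  exact hca N e

end Basics

/-! ### Isometric embeddings of quotients into C₀ spaces -/

section CoordSystem

variable {k : Type u} [NormedField k] {V : Type v} [NormedAddCommGroup V] [NormedSpace k V]

/-- A family of linear forms which on `B` induces an isometric embedding of `B / A` into
`C₀(I, k)`, the distances to `A` being attained. -/
structure IsCoordSystem {I : Type w} (φ : I → V →ₗ[k] k) (A B : Submodule k V) : Prop where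
  le : A ≤ B
  finite : ∀ b ∈ B, ∀ ε > 0, {i | ε ≤ ‖φ i b‖}.Finite
  norm_le : ∀ b ∈ B, ∀ i, ‖φ i b‖ ≤ ‖b‖
  map_eq_zero : ∀ a ∈ A, ∀ i, φ i a = 0
  exists_norm_sub_le : ∀ b ∈ B, ∃ a ∈ A, ∀ r, 0 ≤ r → (∀ i, ‖φ i b‖ ≤ r) → ‖b - a‖ ≤ r

theorem IsCoordSystem.restrict {I : Type w} {φ : I → V →ₗ[k] k} {A B C : Submodule k V}
    (h : IsCoordSystem φ A B) (hAC : A ≤ C) (hCB : C ≤ B) : IsCoordSystem φ A C where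
  le := hAC
  finite b hb := h.finite b (hCB hb)
  norm_le b hb := h.norm_le b (hCB hb)
  map_eq_zero := h.map_eq_zero
  exists_norm_sub_le b hb := h.exists_norm_sub_le b (hCB hb)

/-- `B` embeds into a free space modulo `A`. -/
def IsRelSubfree (A B : Submodule k V) : Prop :=
  ∃ (I : Type v) (φ : I → V →ₗ[k] k), IsCoordSystem φ A B

theorem IsRelSubfree.restrict {A B C : Submodule k V} (h : IsRelSubfree A B) (hAC : A ≤ C)
    (hCB : C ≤ B) : IsRelSubfree A C := by
  obtain ⟨I, φ, hφ⟩ := h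
  exact ⟨I, φ, hφ.restrict hAC hCB⟩

variable [IsUltrametricDist V]

/-- Linear forms on `B` reading off the coefficients of an expansion. -/
theorem IsOrthonormalSet.exists_coord [CompleteSpace V] [CompleteSpace k] {T : Set V}
    (hT : IsOrthonormalSet k T) : ∃ φ : T → V →ₗ[k] k, ∀ x ∈ closedSpan (k := k) T,
      Tendsto (fun e => φ e x) cofinite (𝓝 0) ∧ HasSum (fun e : T => φ e x • (e : V)) x := by
  set A := closedSpan (k := k) T
  have h : ∀ x : A, ∃ c : T → k, Tendsto c cofinite (𝓝 0) ∧
      HasSum (fun e : T => c e • (e : V)) x := fun x => hT.exists_hasSum x.2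
  choose c hc hs using h
  have huniq : ∀ d d' : T → k, ∀ x : V, HasSum (fun e : T => d e • (e : V)) x →
      HasSum (fun e : T => d' e • (e : V)) x → d = d' := by
    intro d d' x h h'
    funext e
    have := hT.norm_le_hasSum (c := fun e => d e - d' e) (x := 0)
      (by simpa only [sub_smul, sub_self] using h.sub h') e
    rwa [norm_zero, norm_le_zero_iff, sub_eq_zero] at this
  let ψ : T → A →ₗ[k] k := fun e =>
    { toFun := fun x => c x e
      map_add' := fun x y => by
        refine congrFun (huniq _ (c x + c y) _ (hs (x + y)) ?_) e
        simpa only [Pi.add_apply, add_smul, Submodule.coe_add] using (hs x).add (hs y)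
      map_smul' := fun a x => by
        refine congrFun (huniq _ (a • c x) _ (hs (a • x)) ?_) e
        simpa only [Pi.smul_apply, smul_eq_mul, mul_smul, Submodule.coe_smul] using
          (hs x).const_smul a }
  -- The algebraic extension to V is arbitrary; only values on the closed span matter.
  choose φ hφ using fun e => LinearMap.exists_extend (ψ e)
  have hφ' : ∀ (e : T) (x : A), φ e x = c x e := fun e x => LinearMap.congr_fun (hφ e) x
  refine ⟨φ, fun x hx => ?_⟩
  have : (fun e => φ e x) = c ⟨x, hx⟩ := funext fun e => hφ' e ⟨x, hx⟩
  constructor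
  · rw [this]; exact hc _
  · have h2 := hs ⟨x, hx⟩
    rw [← this] at h2
    exact h2

theorem finite_of_tendsto {I : Type w} {c : I → k} (hc : Tendsto c cofinite (𝓝 0)) {ε : ℝ}
    (hε : 0 < ε) : {i | ε ≤ ‖c i‖}.Finite := by
  have := Metric.tendsto_nhds.1 hc ε hε
  rw [Filter.eventually_cofinite] at this
  simpa using this

/-- The coordinates outside T₁ serve; a best approximation to b is the part of its expansion carried
by T₁. -/
theorem isRelSubfree_of_subset [CompleteSpace V] [CompleteSpace k] {T T₁ : Set V}
    (hT : IsOrthonormalSet k T) (h : T₁ ⊆ T) :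
    IsRelSubfree (closedSpan (k := k) T₁) (closedSpan (k := k) T) := by
  classical
  obtain ⟨φ, hφ⟩ := hT.exists_coord
  have hle := closedSpan_mono (k := k) h
  have hnorm : ∀ b ∈ closedSpan (k := k) T, ∀ e, ‖φ e b‖ ≤ ‖b‖ := fun b hb e =>
    hT.norm_le_hasSum (c := fun e => φ e b) (hφ b hb).2 e
  refine ⟨{e : T // (e : V) ∉ T₁}, fun e => φ e, ?_⟩
  refine ⟨hle, fun b hb ε hε => ?_, fun b hb e => hnorm b hb e, ?_, ?_⟩
  · exact Set.Finite.preimage (f := fun i : {e : T // (e : V) ∉ T₁} => (i : T))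
      Subtype.val_injective.injOn (finite_of_tendsto (hφ b hb).1 hε)
  · intro a ha e
    have hspan : ∀ y ∈ Submodule.span k T₁, ‖φ e a‖ ≤ ‖a - y‖ := by
      intro y hy
      have h0 : φ e y = 0 := by
        induction hy using Submodule.span_induction with
        | mem t ht =>
          have hsum := (hφ t (subset_closedSpan T (h ht))).2
          have h1 := hasSum_piSingle_smul (k := k) (h ht)
          have h2 := hT.norm_le_hasSum
            (c := fun i => φ i t - (Pi.single (⟨t, h ht⟩ : T) (1 : k) : T → k) i) (x := 0)
            (by simpa only [sub_smul, sub_self] using hsum.sub h1) e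
          have hne : (e : T) ≠ ⟨t, h ht⟩ := fun hh => e.2 (by rw [hh]; exact ht)
          rwa [norm_zero, norm_le_zero_iff, Pi.single_eq_of_ne hne, sub_zero] at h2
        | zero => simp
        | add x y _ _ hx hy => rw [map_add, hx, hy, add_zero]
        | smul c x _ hx => rw [map_smul, hx, smul_zero]
      have := hnorm (a - y) (Submodule.sub_mem _ (hle ha) (hle (span_le_closedSpan _ hy))) e
      rwa [map_sub, h0, sub_zero] at this
    have : ‖φ e a‖ ≤ 0 := by
      refine le_of_forall_pos_le_add fun ε hε => ?_
      obtain ⟨y, hy, hay⟩ := mem_closedSpan_iff.1 ha ε hε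
      rw [zero_add]
      exact (hspan y hy).trans hay.le
    exact norm_le_zero_iff.1 this
  · intro b hb
    set c : T → k := fun e => if (e : V) ∈ T₁ then φ e b else 0 with hc
    have hc0 : Tendsto c cofinite (𝓝 0) := by
      refine squeeze_zero_norm (fun e => ?_) (tendsto_zero_iff_norm_tendsto_zero.1 (hφ b hb).1)
      by_cases he : (e : V) ∈ T₁ <;> simp [hc, he]
    obtain ⟨a, ha⟩ := hT.summable hc0
    have haA : a ∈ closedSpan (k := k) T₁ := by
      refine (isClosed_closedSpan (k := k) T₁).mem_of_tendsto ha (Eventually.of_forall fun F => ?_)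
      refine Submodule.sum_mem _ fun e _ => ?_
      by_cases he : (e : V) ∈ T₁
      · exact Submodule.smul_mem _ _ (subset_closedSpan T₁ he)
      · simp [hc, he]
    refine ⟨a, haA, fun r hr hle => norm_le_of_hasSum ((hφ b hb).2.sub ha) hr fun e => ?_⟩
    rw [← sub_smul, norm_smul, (hT e e.2).1, mul_one]
    by_cases he : (e : V) ∈ T₁
    · simp [hc, he, hr]
    · simpa [hc, he] using hle ⟨e, he⟩

end CoordSystem

/-! ### Countable generation and orthogonalization -/

section Subspaces

variable {k : Type u} [NormedField k] {V : Type v} [NormedAddCommGroup V] [NormedSpace k V]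

theorem exists_norm_lt_of_one_lt (hk : ∃ c : k, 1 < ‖c‖) {ε : ℝ} (hε : 0 < ε) :
    ∃ c : k, c ≠ 0 ∧ ‖c‖ < ε := by
  obtain ⟨a, ha⟩ := hk
  have ha0 : a ≠ 0 := norm_pos_iff.1 (one_pos.trans ha)
  obtain ⟨n, hn⟩ := exists_pow_lt_of_lt_one hε (inv_lt_one_of_one_lt₀ ha)
  exact ⟨a⁻¹ ^ n, pow_ne_zero _ (inv_ne_zero ha0), by rwa [norm_pow, norm_inv]⟩

theorem eq_zero_or_exists_norm_max {I : Type w} {c : I → k}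
    (hc : ∀ ε > 0, {i | ε ≤ ‖c i‖}.Finite) (J : Set I) :
    (∀ i ∈ J, c i = 0) ∨ ∃ i ∈ J, c i ≠ 0 ∧ ∀ j ∈ J, ‖c j‖ ≤ ‖c i‖ := by
  by_cases h : ∀ i ∈ J, c i = 0
  · exact Or.inl h
  push Not at h
  obtain ⟨i₀, hi₀, h₀⟩ := h
  have hpos : 0 < ‖c i₀‖ := norm_pos_iff.2 h₀
  obtain ⟨i, ⟨hiJ, hi⟩, hmax⟩ := Set.exists_max_image (J ∩ {i | ‖c i₀‖ ≤ ‖c i‖})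
    (fun i => ‖c i‖) ((hc _ hpos).inter_of_right J) ⟨i₀, hi₀, le_refl ‖c i₀‖⟩
  refine Or.inr ⟨i, hiJ, norm_pos_iff.1 (hpos.trans_le hi), fun j hj => ?_⟩
  by_cases hj' : ‖c i₀‖ ≤ ‖c j‖
  · exact hmax j ⟨hj, hj'⟩
  · exact (not_le.1 hj').le.trans hi

/-- A scalar is an integral multiple of any scalar at least as large, so this makes O_k-submodules
of k countably generated. If no largest value exists, one witness above each rational threshold
suffices. -/
theorem exists_countable_norm_cofinal (f : V →ₗ[k] k) (W : Set V) :
    ∃ D ⊆ W, D.Countable ∧ ∀ w ∈ W, ∃ d ∈ D, ‖f w‖ ≤ ‖f d‖ := by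
  by_cases hmax : ∃ d ∈ W, ∀ w ∈ W, ‖f w‖ ≤ ‖f d‖
  · obtain ⟨d, hd, h⟩ := hmax
    exact ⟨{d}, Set.singleton_subset_iff.2 hd, Set.countable_singleton d,
      fun w hw => ⟨d, rfl, h w hw⟩⟩
  push Not at hmax
  let Q : Set ℚ := {q | ∃ w ∈ W, (q : ℝ) < ‖f w‖}
  choose g hgW hg using fun q : Q => q.2
  refine ⟨Set.range g, Set.range_subset_iff.2 hgW, Set.countable_range g, fun w hw => ?_⟩
  obtain ⟨w', hw', hlt⟩ := hmax w hw
  obtain ⟨q, hq, hq'⟩ := exists_rat_btwn hlt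
  exact ⟨g ⟨q, w', hw', hq'⟩, Set.mem_range_self _, (hq.trans (hg ⟨q, w', hw', hq'⟩)).le⟩

/-- Modulo the joint kernel of finitely many linear forms, a submodule over the valuation ring is
countably generated. -/
theorem exists_countable_generators {I : Type w} (φ : I → V →ₗ[k] k) (F : Finset I)
    (W : AddSubgroup V) (hW : ∀ c : k, ‖c‖ ≤ 1 → ∀ x ∈ W, c • x ∈ W) :
    ∃ Z ⊆ (W : Set V), Z.Countable ∧
      ∀ x ∈ W, ∃ z ∈ W, z ∈ Submodule.span k Z ∧ ∀ i ∈ F, φ i (x - z) = 0 := by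
  classical
  induction F using Finset.induction_on generalizing W with
  | empty =>
    exact ⟨∅, Set.empty_subset _, Set.countable_empty,
      fun x _ => ⟨0, W.zero_mem, Submodule.zero_mem _, by simp⟩⟩
  | insert j F _ ih =>
    let W' : AddSubgroup V := W ⊓ (LinearMap.ker (φ j)).toAddSubgroup
    have hmem : ∀ x, x ∈ W' ↔ x ∈ W ∧ φ j x = 0 := fun x => Iff.rfl
    obtain ⟨Z, hZW, hZ, h⟩ := ih W' fun c hc x hx => by
      rw [hmem] at hx ⊢
      exact ⟨hW c hc x hx.1, by rw [map_smul, hx.2, smul_zero]⟩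
    obtain ⟨D, hDW, hD, hDmax⟩ := exists_countable_norm_cofinal (φ j) (W : Set V)
    refine ⟨Z ∪ D, Set.union_subset (fun z hz => ((hmem z).1 (hZW hz)).1) hDW, hZ.union hD,
      fun x hx => ?_⟩
    obtain ⟨d, hd, hle⟩ := hDmax x hx
    -- If `φ j d = 0`, the quotient is 0 by convention, and `hle` forces `φ j x = 0` too.
    set c := φ j x / φ j d with hc
    have hc1 : ‖c‖ ≤ 1 := by
      rw [hc, norm_div]
      exact div_le_one_of_le₀ hle (norm_nonneg _)
    have hcd : φ j (c • d) = φ j x := by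
      rw [map_smul, smul_eq_mul, hc]
      by_cases h0 : φ j d = 0
      · rw [h0, norm_zero, norm_le_zero_iff] at hle
        rw [h0, hle, mul_zero]
      · exact div_mul_cancel₀ _ h0
    have hcW : c • d ∈ W := hW c hc1 d (hDW hd)
    obtain ⟨z, hzW, hz, hzF⟩ := h (x - c • d)
      ((hmem _).2 ⟨W.sub_mem hx hcW, by rw [map_sub, hcd, sub_self]⟩)
    have hz' := (hmem z).1 hzW
    refine ⟨z + c • d, W.add_mem hz'.1 hcW, Submodule.add_mem _
      (Submodule.span_mono Set.subset_union_left hz)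
      (Submodule.smul_mem _ _ (Submodule.subset_span (Or.inr hd))), fun i hi => ?_⟩
    rcases Finset.mem_insert.1 hi with rfl | hi
    · rw [map_sub, map_add, hz'.2, hcd, zero_add, sub_self]
    · rw [add_comm, ← sub_sub]
      exact hzF i hi

/-- The vectors of `B` whose coordinates vanish outside `J`. -/
def supportedOn {I : Type w} (φ : I → V →ₗ[k] k) (B : Submodule k V) (J : Set I) :
    Submodule k V :=
  B ⊓ ⨅ i ∈ Jᶜ, LinearMap.ker (φ i)

theorem mem_supportedOn {I : Type w} {φ : I → V →ₗ[k] k} {B : Submodule k V} {J : Set I}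
    {x : V} : x ∈ supportedOn φ B J ↔ x ∈ B ∧ ∀ i ∉ J, φ i x = 0 := by
  simp [supportedOn]

variable [IsUltrametricDist k]

/-- The vectors of `B` whose coordinates in `J` are integral. -/
def integralOn {I : Type w} (φ : I → V →ₗ[k] k) (B : Submodule k V) (J : Set I) :
    AddSubgroup V where
  carrier := {x | x ∈ B ∧ ∀ i ∈ J, ‖φ i x‖ ≤ 1}
  zero_mem' := ⟨B.zero_mem, fun i _ => by simp⟩
  add_mem' := fun hx hy => ⟨B.add_mem hx.1 hy.1, fun i hi => by
    rw [map_add]; exact norm_add_le_of_le (hx.2 i hi) (hy.2 i hi)⟩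
  neg_mem' := fun hx => ⟨B.neg_mem hx.1, fun i hi => by
    rw [map_neg, norm_neg]; exact hx.2 i hi⟩

/-- A single countable set serves all x whose non-integral coordinates lie in F: generators of the
vectors integral on J \ F allow an exact correction on F without spoiling integrality elsewhere. -/
theorem exists_countable_approximation {I : Type w} (φ : I → V →ₗ[k] k) (B : Submodule k V)
    (J : Set I) (F : Finset I) :
    ∃ Z ⊆ (B : Set V), Z.Countable ∧ ∀ x ∈ B, (∀ i ∈ J, i ∉ F → ‖φ i x‖ ≤ 1) →
      ∃ z ∈ Submodule.span k Z, ∀ i ∈ J, ‖φ i (x - z)‖ ≤ 1 := by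
  obtain ⟨Z, hZW, hZ, h⟩ := exists_countable_generators φ F (integralOn φ B (J \ F)) (by
    rintro c hc x ⟨hx, hx'⟩
    refine ⟨B.smul_mem c hx, fun i hi => ?_⟩
    rw [map_smul, norm_smul]
    exact mul_le_one₀ hc (norm_nonneg _) (hx' i hi))
  refine ⟨Z, fun z hz => (hZW hz).1, hZ, fun x hx hx' => ?_⟩
  obtain ⟨z, hzW, hz, hzF⟩ := h x ⟨hx, fun i hi => hx' i hi.1 hi.2⟩
  refine ⟨z, hz, fun i hi => ?_⟩
  by_cases hiF : i ∈ F
  · rw [hzF i hiF, norm_zero]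
    exact zero_le_one
  · rw [map_sub]
    exact norm_sub_le_of_le (hx' i hi hiF) (hzW.2 i ⟨hi, hiF⟩)

theorem IsCoordSystem.exists_countable_generating {I : Type w} [Countable I]
    {φ : I → V →ₗ[k] k} {A B : Submodule k V} (h : IsCoordSystem φ A B)
    (hk : ∃ c : k, 1 < ‖c‖) :
    ∃ Z ⊆ (B : Set V), Z.Countable ∧ B ≤ closedSpan (k := k) ((A : Set V) ∪ Z) := by
  choose Z hZB hZ hap using exists_countable_approximation φ B Set.univ
  refine ⟨⋃ F, Z F, Set.iUnion_subset hZB, Set.countable_iUnion hZ, fun b hb => ?_⟩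
  refine mem_closedSpan_iff.2 fun ε hε => ?_
  -- Dividing by c turns approximation within ε into integrality of coordinates.
  obtain ⟨c, hc0, hcε⟩ := exists_norm_lt_of_one_lt hk hε
  have hc : 0 < ‖c‖ := norm_pos_iff.2 hc0
  have hF := h.finite b hb ‖c‖ hc
  obtain ⟨z, hz, hbz⟩ := hap hF.toFinset (c⁻¹ • b) (B.smul_mem _ hb) (by
    intro i _ hi
    rw [Set.Finite.mem_toFinset, Set.mem_ofPred_eq, not_le] at hi
    rw [map_smul, norm_smul, norm_inv, inv_mul_le_one₀ hc]
    exact hi.le)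
  have hzB : z ∈ B := Submodule.span_le.2 (hZB _) hz
  obtain ⟨a, ha, hba⟩ := h.exists_norm_sub_le (c⁻¹ • b - z)
    (B.sub_mem (B.smul_mem _ hb) hzB)
  refine ⟨c • (z + a), Submodule.smul_mem _ _ (Submodule.add_mem _ ?_ ?_), ?_⟩
  · exact Submodule.span_mono
      ((Set.subset_iUnion Z hF.toFinset).trans Set.subset_union_right) hz
  · exact Submodule.subset_span (Or.inl ha)
  · have : b - c • (z + a) = c • (c⁻¹ • b - z - a) := by
      rw [sub_sub, smul_sub, smul_inv_smul₀ hc0]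
    rw [this, norm_smul]
    refine lt_of_le_of_lt (mul_le_of_le_one_right (norm_nonneg _) ?_) hcε
    exact hba 1 zero_le_one fun i => hbz i (Set.mem_univ i)

variable [IsUltrametricDist V]

/-- One step of the orthogonalization process. -/
theorem IsCoordSystem.exists_insert {I : Type w} {φ : I → V →ₗ[k] k} {A B : Submodule k V}
    (h : IsCoordSystem φ A B) {T : Set V} (hT : IsOrthonormalSet k T) (hTA : T ⊆ A)
    (hAT : A ≤ closedSpan (k := k) T) {z : V} (hz : z ∈ B) :
    ∃ (T' : Set V) (A' : Submodule k V) (φ' : I → V →ₗ[k] k), T ⊆ T' ∧ IsOrthonormalSet k T' ∧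
      T' ⊆ A' ∧ A' ≤ closedSpan (k := k) T' ∧ IsCoordSystem φ' A' B ∧ z ∈ A' := by
  obtain ⟨a, ha, hza⟩ := h.exists_norm_sub_le z hz
  rcases eq_zero_or_exists_norm_max (h.finite z hz) Set.univ with h0 | ⟨i, -, hi0, hmax⟩
  · refine ⟨T, A, φ, subset_rfl, hT, hTA, hAT, h, ?_⟩
    have := hza 0 le_rfl fun i => by rw [h0 i (Set.mem_univ i), norm_zero]
    rw [norm_le_zero_iff, sub_eq_zero] at this
    rwa [this]
  have haB := h.le ha
  -- Normalized at a coordinate where z is largest, t is a unit vector orthogonal to A.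
  obtain ⟨t, ht⟩ : ∃ t : V, t = (φ i z)⁻¹ • (z - a) := ⟨_, rfl⟩
  have htB : t ∈ B := ht ▸ B.smul_mem _ (B.sub_mem hz haB)
  have hti : φ i t = 1 := by
    rw [ht, map_smul, map_sub, h.map_eq_zero a ha, sub_zero, smul_eq_mul, inv_mul_cancel₀ hi0]
  have htn : ‖t‖ ≤ 1 := by
    rw [ht, norm_smul, norm_inv, inv_mul_le_one₀ (norm_pos_iff.2 hi0)]
    exact hza _ (norm_nonneg _) fun j => hmax j (Set.mem_univ j)
  have hφt : ∀ j, ‖φ j t‖ ≤ 1 := fun j => (h.norm_le t htB j).trans htn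
  have htA : ∀ y ∈ A, ∀ c : k, ‖c • t‖ ≤ ‖y + c • t‖ := by
    intro y hy c
    have h1 := h.norm_le (y + c • t) (B.add_mem (h.le hy) (B.smul_mem c htB)) i
    rw [map_add, map_smul, h.map_eq_zero y hy, hti, zero_add, smul_eq_mul, mul_one] at h1
    rw [norm_smul]
    exact (mul_le_of_le_one_right (norm_nonneg _) htn).trans h1
  have htn' : ‖t‖ = 1 := by
    refine le_antisymm htn ?_
    have := h.norm_le t htB i
    rwa [hti, norm_one] at this
  have hsingle : IsOrthonormalSet k ({t} : Set V) := by
    rintro e rfl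
    refine ⟨htn', fun y hy => ?_⟩
    rw [sdiff_self, Set.bot_eq_empty, Submodule.span_empty, Submodule.mem_bot] at hy
    rw [hy, add_zero, htn']
  have hspanA : Submodule.span k T ≤ A := Submodule.span_le.2 hTA
  -- Elimination: the new forms kill t as well as A, and remain bounded by the norm because `‖φ j t‖
  -- ≤ 1`.
  refine ⟨T ∪ {t}, A ⊔ Submodule.span k {t}, fun j => φ j - φ j t • φ i, Set.subset_union_left,
    hT.union hsingle ?_, ?_, ?_, ?_, ?_⟩
  · intro y hy w hw
    obtain ⟨c, rfl⟩ := Submodule.mem_span_singleton.1 hw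
    exact htA y (hspanA hy) c
  · refine Set.union_subset (fun x hx => Submodule.mem_sup_left (hTA hx)) ?_
    rintro x rfl
    exact Submodule.mem_sup_right (Submodule.mem_span_singleton_self _)
  · refine sup_le (hAT.trans (closedSpan_mono Set.subset_union_left)) ?_
    exact (Submodule.span_mono Set.subset_union_right).trans (span_le_closedSpan _)
  · have hsmall : ∀ b ∈ B, ∀ j, ‖φ j t * φ i b‖ ≤ ‖φ i b‖ := fun b _ j => by
      rw [norm_mul]
      exact mul_le_of_le_one_left (norm_nonneg _) (hφt j)
    refine ⟨sup_le h.le ((Submodule.span_singleton_le_iff_mem _ _).2 htB), ?_, ?_, ?_, ?_⟩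
    · intro b hb ε hε
      have h1 := h.finite b hb ε hε
      have h2 := h.finite (φ i b • t) (B.smul_mem _ htB) ε hε
      refine (h1.union h2).subset fun j hj => ?_
      by_contra hcon
      rw [Set.mem_union, not_or, Set.mem_ofPred_eq, Set.mem_ofPred_eq, not_le, not_le] at hcon
      have hj' : ε ≤ ‖φ j b - φ j t * φ i b‖ := hj
      rw [map_smul, smul_eq_mul, mul_comm] at hcon
      have := IsUltrametricDist.norm_add_le_max (φ j b) (-(φ j t * φ i b))
      rw [norm_neg, ← sub_eq_add_neg] at this
      exact absurd (hj'.trans this) (not_le.2 (max_lt hcon.1 hcon.2))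
    · intro b hb j
      change ‖φ j b - φ j t * φ i b‖ ≤ ‖b‖
      exact norm_sub_le_of_le (h.norm_le b hb j) ((hsmall b hb j).trans (h.norm_le b hb i))
    · intro x hx j
      obtain ⟨y, hy, w, hw, rfl⟩ := Submodule.mem_sup.1 hx
      obtain ⟨c, rfl⟩ := Submodule.mem_span_singleton.1 hw
      change φ j (y + c • t) - φ j t * φ i (y + c • t) = 0
      rw [map_add, map_add, map_smul, map_smul, h.map_eq_zero y hy, h.map_eq_zero y hy, hti]
      simp only [smul_eq_mul]
      ring
    · intro b hb
      obtain ⟨a', ha', hle⟩ := h.exists_norm_sub_le (b - φ i b • t)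
        (B.sub_mem hb (B.smul_mem _ htB))
      refine ⟨a' + φ i b • t, Submodule.add_mem _ (Submodule.mem_sup_left ha')
        (Submodule.mem_sup_right (Submodule.mem_span_singleton.2 ⟨_, rfl⟩)), fun r hr hbr => ?_⟩
      rw [add_comm, ← sub_sub]
      refine hle r hr fun j => ?_
      rw [map_sub, map_smul, smul_eq_mul, mul_comm]
      exact hbr j
  · have : z = a + φ i z • t := by
      rw [ht, smul_inv_smul₀ hi0, add_sub_cancel]
    rw [this]
    exact Submodule.add_mem _ (Submodule.mem_sup_left ha)
      (Submodule.mem_sup_right (Submodule.mem_span_singleton.2 ⟨_, rfl⟩))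

/-- Gram–Schmidt along a countable generating set. The coordinates change at each step, so they are
part of the inductive state. -/
theorem IsCoordSystem.exists_extend_of_countable {I : Type w} [Countable I]
    {φ : I → V →ₗ[k] k} {A B : Submodule k V} (h : IsCoordSystem φ A B)
    (hk : ∃ c : k, 1 < ‖c‖) {T : Set V} (hT : IsOrthonormalSet k T) (hTA : T ⊆ A)
    (hAT : A ≤ closedSpan (k := k) T) :
    ∃ T' : Set V, T ⊆ T' ∧ IsOrthonormalSet k T' ∧ T' ⊆ B ∧ B ≤ closedSpan (k := k) T' := by
  obtain ⟨Z, hZB, hZ, hB⟩ := h.exists_countable_generating hk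
  obtain ⟨z, hz⟩ := (hZ.insert 0).exists_eq_range (Set.insert_nonempty 0 Z)
  have hzB : ∀ n, z n ∈ B := fun n => by
    rcases (hz ▸ Set.mem_range_self n : z n ∈ insert 0 Z) with h0 | h1
    · rw [h0]; exact B.zero_mem
    · exact hZB h1
  let P : Set V → Prop := fun S => ∃ (A' : Submodule k V) (φ' : I → V →ₗ[k] k),
    IsOrthonormalSet k S ∧ S ⊆ A' ∧ A' ≤ closedSpan (k := k) S ∧ IsCoordSystem φ' A' B
  have hstep : ∀ (n : ℕ) (S : {S : Set V // P S}), ∃ S' : {S : Set V // P S},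
      S.1 ⊆ S'.1 ∧ z n ∈ closedSpan (k := k) S'.1 := by
    rintro n ⟨S, A', φ', h1, h2, h3, h4⟩
    obtain ⟨S', A'', φ'', g0, g1, g2, g3, g4, g5⟩ := h4.exists_insert h1 h2 h3 (hzB n)
    exact ⟨⟨S', A'', φ'', g1, g2, g3, g4⟩, g0, g3 g5⟩
  choose f hf hfz using hstep
  let S : ℕ → {S : Set V // P S} := fun n => Nat.rec ⟨T, A, φ, hT, hTA, hAT, h⟩ f n
  have hmono : Monotone fun n => (S n).1 := monotone_nat_of_le_succ fun n => hf n (S n)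
  have hSB : ∀ n, (S n).1 ⊆ B := fun n => by
    obtain ⟨A', φ', -, h2, -, h4⟩ := (S n).2
    exact h2.trans h4.le
  refine ⟨⋃ n, (S n).1, Set.subset_iUnion (fun n => (S n).1) 0, ?_, Set.iUnion_subset hSB, ?_⟩
  · rw [← Set.sUnion_range]
    refine isOrthonormalSet_sUnion ?_ ?_
    · rw [directedOn_range]
      exact hmono.directed_le
    · rintro _ ⟨n, rfl⟩
      obtain ⟨A', φ', h1, -⟩ := (S n).2
      exact h1
  · refine hB.trans (closedSpan_le_closedSpan (Set.union_subset ?_ ?_))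
    · exact fun a ha => closedSpan_mono (Set.subset_iUnion (fun n => (S n).1) 0) (hAT ha)
    · intro x hx
      obtain ⟨n, rfl⟩ : x ∈ Set.range z := hz ▸ Set.mem_insert_of_mem 0 hx
      exact closedSpan_mono (Set.subset_iUnion (fun n => (S n).1) (n + 1)) (hfz n (S n))

end Subspaces

/-! ### The relative Gruson theorem -/

section Subfree

variable {k : Type u} [NormedField k] {V : Type v} [NormedAddCommGroup V] [NormedSpace k V]

theorem supportedOn_le {I : Type w} {φ : I → V →ₗ[k] k} {B : Submodule k V} {J : Set I} :
    supportedOn φ B J ≤ B := inf_le_left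

theorem supportedOn_mono {I : Type w} {φ : I → V →ₗ[k] k} {B : Submodule k V} {J J' : Set I}
    (h : J ⊆ J') : supportedOn φ B J ≤ supportedOn φ B J' := fun x hx => by
  rw [mem_supportedOn] at hx ⊢
  exact ⟨hx.1, fun i hi => hx.2 i fun hi' => hi (h hi')⟩

/-- The coordinates outside `J` embed `B` isometrically modulo the vectors supported on `J`. -/
def IsGoodSet {I : Type w} (φ : I → V →ₗ[k] k) (B : Submodule k V) (J : Set I) : Prop :=
  ∀ b ∈ B, ∃ a ∈ supportedOn φ B J, ∀ r, 0 ≤ r → (∀ i ∉ J, ‖φ i b‖ ≤ r) → ‖b - a‖ ≤ r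

/-- Coordinates outside J' vanish on the larger space, so goodness of J is enough. For countable J'
\ J this leads back to the countable case. -/
theorem IsGoodSet.isCoordSystem {I : Type w} {φ : I → V →ₗ[k] k} {A B : Submodule k V}
    (h : IsCoordSystem φ A B) {J J' : Set I} (hJ : IsGoodSet φ B J) (hJJ' : J ⊆ J') :
    IsCoordSystem (fun i : (J' \ J : Set I) => φ i) (supportedOn φ B J)
      (supportedOn φ B J') where
  le := supportedOn_mono hJJ'
  finite b hb ε hε := Set.Finite.preimage (f := fun i : (J' \ J : Set I) => (i : I))
      Subtype.val_injective.injOn (h.finite b (supportedOn_le hb) ε hε)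
  norm_le b hb i := h.norm_le b (supportedOn_le hb) i
  map_eq_zero a ha i := (mem_supportedOn.1 ha).2 i i.2.2
  exists_norm_sub_le b hb := by
    obtain ⟨a, ha, hba⟩ := hJ b (supportedOn_le hb)
    refine ⟨a, ha, fun r hr hle => hba r hr fun i hi => ?_⟩
    by_cases hi' : i ∈ J'
    · exact hle ⟨i, hi', hi⟩
    · rw [(mem_supportedOn.1 hb).2 i hi', norm_zero]
      exact hr

theorem isGoodSet_empty {I : Type w} {φ : I → V →ₗ[k] k} {A B : Submodule k V}
    (h : IsCoordSystem φ A B) : IsGoodSet φ B ∅ := fun b hb => by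
  obtain ⟨a, ha, hba⟩ := h.exists_norm_sub_le b hb
  exact ⟨a, mem_supportedOn.2 ⟨h.le ha, fun i _ => h.map_eq_zero a ha i⟩,
    fun r hr hle => hba r hr fun i => hle i (Set.notMem_empty i)⟩

theorem supportedOn_empty_le {I : Type w} {φ : I → V →ₗ[k] k} {A B : Submodule k V}
    (h : IsCoordSystem φ A B) : supportedOn φ B ∅ ≤ A := fun x hx => by
  rw [mem_supportedOn] at hx
  obtain ⟨a, ha, hxa⟩ := h.exists_norm_sub_le x hx.1
  have := hxa 0 le_rfl fun i => by rw [hx.2 i (Set.notMem_empty i), norm_zero]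
  rw [norm_le_zero_iff, sub_eq_zero] at this
  rwa [this]

/-- Goodness only has to be tested at the largest coordinate outside the set. -/
theorem isGoodSet_of_forall {I : Type w} {φ : I → V →ₗ[k] k} {A B : Submodule k V}
    (h : IsCoordSystem φ A B) {J : Set I}
    (hJ : ∀ b ∈ B, ∀ i ∉ J, φ i b ≠ 0 → (∀ j ∉ J, ‖φ j b‖ ≤ ‖φ i b‖) →
      ∃ a ∈ supportedOn φ B J, ‖b - a‖ ≤ ‖φ i b‖) : IsGoodSet φ B J := fun b hb => by
  rcases eq_zero_or_exists_norm_max (h.finite b hb) Jᶜ with h0 | ⟨i, hi, hi0, hmax⟩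
  · exact ⟨b, mem_supportedOn.2 ⟨hb, h0⟩, fun r hr _ => by rwa [sub_self, norm_zero]⟩
  · obtain ⟨a, ha, hba⟩ := hJ b hb i hi hi0 hmax
    exact ⟨a, ha, fun r _ hr => hba.trans (hr i hi)⟩

/-- Only finitely many coordinates inside the union reach the largest one outside it; a member
containing them all already supplies the approximant. -/
theorem isGoodSet_sUnion {I : Type w} {φ : I → V →ₗ[k] k} {A B : Submodule k V}
    (h : IsCoordSystem φ A B) {C : Set (Set I)} (hC : DirectedOn (· ⊆ ·) C) (hne : C.Nonempty)
    (hg : ∀ J ∈ C, IsGoodSet φ B J) : IsGoodSet φ B (⋃₀ C) := by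
  refine isGoodSet_of_forall h fun b hb i hi hi0 hmax => ?_
  have hfin : (⋃₀ C ∩ {j | ‖φ i b‖ ≤ ‖φ j b‖}).Finite :=
    (h.finite b hb _ (norm_pos_iff.2 hi0)).inter_of_right _
  obtain ⟨J, hJ, hsub⟩ := hC.exists_mem_subset_of_finset_subset_biUnion (f := id)
    (s := hfin.toFinset) hne (by
      intro j hj
      obtain ⟨⟨J, hJ, hjJ⟩, -⟩ := hfin.mem_toFinset.1 hj
      exact Set.mem_biUnion hJ hjJ)
  obtain ⟨a, ha, hba⟩ := hg J hJ b hb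
  refine ⟨a, supportedOn_mono (Set.subset_sUnion_of_mem hJ) ha,
    hba _ (norm_nonneg _) fun j hj => ?_⟩
  by_cases hjC : j ∈ ⋃₀ C
  · by_contra hcon
    exact hj (hsub (hfin.mem_toFinset.2 ⟨hjC, (not_le.1 hcon).le⟩))
  · exact hmax j hjC

variable [IsUltrametricDist k]

theorem IsGoodSet.exists_insert {I : Type w} {φ : I → V →ₗ[k] k} {A B : Submodule k V}
    (h : IsCoordSystem φ A B) {J : Set I} (hJ : IsGoodSet φ B J) (i₀ : I) :
    ∃ J' : Set I, J ⊆ J' ∧ i₀ ∈ J' ∧ (J' \ J).Countable ∧ IsGoodSet φ B J' := by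
  choose Z hZB hZ hap using exists_countable_approximation φ B Jᶜ
  have hsupp : ∀ b ∈ B, {i | φ i b ≠ 0}.Countable := by
    intro b hb
    have : {i | φ i b ≠ 0} ⊆ ⋃ n : ℕ, {i | 1 / ((n : ℝ) + 1) ≤ ‖φ i b‖} := by
      intro i hi
      obtain ⟨n, hn⟩ := exists_nat_one_div_lt (norm_pos_iff.2 hi)
      exact Set.mem_iUnion.2 ⟨n, hn.le⟩
    exact (Set.countable_iUnion fun n : ℕ =>
      (h.finite b hb _ (Nat.one_div_pos_of_nat (α := ℝ) (n := n))).countable).mono this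
  -- Iterating g closes K under the supports of all vectors in Z F, for F a finite subset of K, and
  -- keeps it countable.
  let g : Set I → Set I := fun K =>
    K ∪ ⋃ F ∈ {F : Finset I | (F : Set I) ⊆ K}, ⋃ z ∈ Z F, {i | φ i z ≠ 0}
  have hg : ∀ K, K.Countable → (g K).Countable := by
    intro K hK
    have hF : {F : Finset I | (F : Set I) ⊆ K}.Countable :=
      ((Set.countable_ofPred_finite_subset hK).preimage Finset.coe_injective).mono
        fun F hF => And.intro F.finite_toSet hF
    exact hK.union (hF.biUnion fun F _ => (hZ F).biUnion fun z hz => hsupp z (hZB F hz))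
  let K : ℕ → Set I := fun n => g^[n] {i₀}
  have hKs : ∀ n, K (n + 1) = g (K n) := fun n => Function.iterate_succ_apply' g n {i₀}
  have hKc : ∀ n, (K n).Countable := fun n => by
    induction n with
    | zero => exact Set.countable_singleton i₀
    | succ n ih => rw [hKs]; exact hg _ ih
  have hKm : Monotone K := monotone_nat_of_le_succ fun n => by
    rw [hKs]; exact Set.subset_union_left
  refine ⟨J ∪ ⋃ n, K n, Set.subset_union_left, Or.inr (Set.mem_iUnion.2 ⟨0, rfl⟩),
    (Set.countable_iUnion hKc).mono (by
      rintro i ⟨hi | hi, hiJ⟩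
      exacts [absurd hi hiJ, hi]), ?_⟩
  refine isGoodSet_of_forall h fun b hb i hi hi0 hmax => ?_
  obtain ⟨c, hc⟩ : ∃ c, c = φ i b := ⟨_, rfl⟩
  rw [← hc] at hi0 hmax ⊢
  have hcpos : 0 < ‖c‖ := norm_pos_iff.2 hi0
  have hfin : ((⋃ n, K n) ∩ {j | ‖c‖ ≤ ‖φ j b‖}).Finite :=
    (h.finite b hb _ hcpos).inter_of_right _
  obtain ⟨n, hn⟩ : ∃ n, (hfin.toFinset : Set I) ⊆ K n := by
    refine DirectedOn.exists_mem_subset_of_finset_subset_biUnion (s := hfin.toFinset)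
      (c := Set.univ) (f := K) ⟨0, trivial⟩ ?_ ?_ |>.imp fun _ h => h.2
    · exact fun a _ b _ => ⟨max a b, trivial, hKm (le_max_left _ _), hKm (le_max_right _ _)⟩
    · intro j hj
      rw [Set.biUnion_univ]
      exact (hfin.mem_toFinset.1 hj).1
  -- After division by the largest outside coordinate, the non-integral coordinates off J lie in a
  -- finite subset of K n. Subtracting z makes them integral, and then goodness of J applies.
  obtain ⟨z, hz, hbz⟩ := hap hfin.toFinset (c⁻¹ • b) (B.smul_mem _ hb) (by
    intro j hj hjF
    rw [map_smul, norm_smul, norm_inv, inv_mul_le_one₀ hcpos]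
    by_cases hjK : j ∈ ⋃ n, K n
    · by_contra hcon
      exact hjF (hfin.mem_toFinset.2 ⟨hjK, (not_le.1 hcon).le⟩)
    · exact hmax j (not_or.2 ⟨hj, hjK⟩))
  have hzS : z ∈ supportedOn φ B (J ∪ ⋃ n, K n) := by
    refine Submodule.span_le.2 (fun y hy => mem_supportedOn.2 ⟨hZB _ hy, fun j hj => ?_⟩) hz
    by_contra hne
    refine hj (Or.inr (Set.mem_iUnion.2 ⟨n + 1, ?_⟩))
    rw [hKs]
    exact Or.inr (Set.mem_biUnion (x := hfin.toFinset) hn (Set.mem_biUnion hy hne))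
  obtain ⟨a, ha, hle⟩ := hJ (c⁻¹ • b - z)
    (B.sub_mem (B.smul_mem _ hb) (supportedOn_le hzS))
  refine ⟨c • (z + a), Submodule.smul_mem _ _ (Submodule.add_mem _ hzS
    (supportedOn_mono Set.subset_union_left ha)), ?_⟩
  have : b - c • (z + a) = c • (c⁻¹ • b - z - a) := by
    rw [sub_sub, smul_sub, smul_inv_smul₀ hi0]
  rw [this, norm_smul]
  exact mul_le_of_le_one_right (norm_nonneg _) (hle 1 zero_le_one fun j hj => hbz j hj)

variable [IsUltrametricDist V]

/-- A relative form of Gruson's theorem on closed subspaces of free Banach spaces. -/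
theorem IsCoordSystem.exists_extend {I : Type w} {φ : I → V →ₗ[k] k} {A B : Submodule k V}
    (h : IsCoordSystem φ A B) (hk : ∃ c : k, 1 < ‖c‖) {T : Set V} (hT : IsOrthonormalSet k T)
    (hTA : T ⊆ A) (hAT : A ≤ closedSpan (k := k) T) :
    ∃ T' : Set V, T ⊆ T' ∧ IsOrthonormalSet k T' ∧ T' ⊆ B ∧ B ≤ closedSpan (k := k) T' := by
  -- Zorn's lemma runs over pairs of a good index set and an orthonormal basis of the vectors
  -- supported on it.
  let 𝒮 : Set (Set I × Set V) := {p | IsGoodSet φ B p.1 ∧ IsOrthonormalSet k p.2 ∧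
    p.2 ⊆ supportedOn φ B p.1 ∧ supportedOn φ B p.1 ≤ closedSpan (k := k) p.2}
  have hchain : ∀ c ⊆ 𝒮, IsChain (· ≤ ·) c → ∀ y ∈ c, ∃ ub ∈ 𝒮, ∀ z ∈ c, z ≤ ub := by
    intro c hc𝒮 hc y hy
    have hd1 : DirectedOn (· ⊆ ·) (Prod.fst '' c) :=
      (hc.image_of_map_rel _ (· ⊆ ·) Prod.fst fun _ _ h => h.1).directedOn
    have hd2 : DirectedOn (· ⊆ ·) (Prod.snd '' c) :=
      (hc.image_of_map_rel _ (· ⊆ ·) Prod.snd fun _ _ h => h.2).directedOn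
    have hub : ∀ z ∈ c, z ≤ (⋃₀ (Prod.fst '' c), ⋃₀ (Prod.snd '' c)) := fun z hz =>
      ⟨Set.subset_sUnion_of_mem ⟨z, hz, rfl⟩, Set.subset_sUnion_of_mem ⟨z, hz, rfl⟩⟩
    refine ⟨(⋃₀ (Prod.fst '' c), ⋃₀ (Prod.snd '' c)), ⟨?_, ?_, ?_, ?_⟩, hub⟩
    · refine isGoodSet_sUnion h hd1 ⟨_, y, hy, rfl⟩ ?_
      rintro _ ⟨p, hp, rfl⟩
      exact (hc𝒮 hp).1
    · refine isOrthonormalSet_sUnion hd2 ?_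
      rintro _ ⟨p, hp, rfl⟩
      exact (hc𝒮 hp).2.1
    · refine Set.sUnion_subset ?_
      rintro _ ⟨p, hp, rfl⟩
      exact (hc𝒮 hp).2.2.1.trans (supportedOn_mono (hub p hp).1)
    · intro b hb
      refine mem_closedSpan_iff.2 fun ε hε => ?_
      have hbB := supportedOn_le hb
      have hfin := h.finite b hbB (ε / 2) (half_pos hε)
      obtain ⟨J, ⟨p, hp, rfl⟩, hsub⟩ := hd1.exists_mem_subset_of_finset_subset_biUnion
        (f := id) (s := hfin.toFinset) (Set.Nonempty.image _ ⟨y, hy⟩) (by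
          intro j hj
          by_contra hcon
          have h0 := (mem_supportedOn.1 hb).2 j (by rw [Set.sUnion_eq_biUnion]; exact hcon)
          have hj' : ε / 2 ≤ ‖φ j b‖ := hfin.mem_toFinset.1 hj
          rw [h0, norm_zero] at hj'
          linarith)
      obtain ⟨a, ha, hba⟩ := (hc𝒮 hp).1 b hbB
      obtain ⟨x, hx, hax⟩ := mem_closedSpan_iff.1 ((hc𝒮 hp).2.2.2 ha) ε hε
      refine ⟨x, Submodule.span_mono (hub p hp).2 hx, ?_⟩
      have h1 : ‖b - a‖ < ε := (hba (ε / 2) (half_pos hε).le fun j hj => by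
        by_contra hcon
        exact hj (hsub (hfin.mem_toFinset.2 (not_le.1 hcon).le))).trans_lt (half_lt_self hε)
      rw [← sub_add_sub_cancel b a x]
      exact (IsUltrametricDist.norm_add_le_max _ _).trans_lt (max_lt h1 hax)
  have hbase : ((∅, T) : Set I × Set V) ∈ 𝒮 := by
    refine ⟨isGoodSet_empty h, hT, fun t ht => ?_, (supportedOn_empty_le h).trans hAT⟩
    exact mem_supportedOn.2 ⟨h.le (hTA ht), fun i _ => h.map_eq_zero t (hTA ht) i⟩
  obtain ⟨⟨J, T'⟩, hle, hmax⟩ := zorn_le_nonempty₀ 𝒮 hchain _ hbase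
  obtain ⟨hJ, hT', hT'J, hJT'⟩ := hmax.prop
  have huniv : J = Set.univ := by
    refine Set.eq_univ_of_forall fun i => ?_
    obtain ⟨J', hJJ', hi, hcount, hJ'⟩ := hJ.exists_insert h i
    have : Countable (J' \ J : Set I) := hcount.to_subtype
    obtain ⟨T'', h1, h2, h3, h4⟩ :=
      (hJ.isCoordSystem h hJJ').exists_extend_of_countable hk hT' hT'J hJT'
    exact (hmax.le_of_ge (y := (J', T'')) ⟨hJ', h2, h3, h4⟩ ⟨hJJ', h1⟩).1 hi
  subst huniv
  refine ⟨T', hle.2, hT', hT'J.trans supportedOn_le, fun b hb => hJT' ?_⟩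
  exact mem_supportedOn.2 ⟨hb, fun i hi => absurd (Set.mem_univ i) hi⟩

end Subfree

/-! ### Freeness in terms of orthonormal sets -/

section Free

variable {k : Type u} [NormedField k] {V : Type v} [NormedAddCommGroup V] [NormedSpace k V]

theorem closedSpan_empty : closedSpan (k := k) (∅ : Set V) = ⊥ :=
  eq_bot_iff.2 (closedSpan_le (by simp) (Set.empty_subset _))

/-- The norm formula is applied to a finitely supported family with coefficient 1 at e. -/
theorem IsOrthonormalSchauderBasis.isOrthonormalSet {E : Set V}
    (hE : IsOrthonormalSchauderBasis k E) : IsOrthonormalSet k E := by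
  classical
  refine fun e he => ⟨hE.norm_eq_one e he, fun y hy => ?_⟩
  obtain ⟨l, hl, rfl⟩ := Submodule.mem_span_set.1 hy
  set m : V →₀ k := Finsupp.single e 1 + l with hm
  have hme : m e = 1 := by
    have : l e = 0 := Finsupp.notMem_support_iff.1 fun h => (hl h).2 rfl
    rw [hm, Finsupp.add_apply, this, Finsupp.single_eq_same, add_zero]
  have hmE : (m.support : Set V) ⊆ E := by
    intro x hx
    rcases Finset.mem_union.1 (Finsupp.support_add hx) with h | h
    · rw [Finset.mem_singleton.1 (Finsupp.support_single_subset h)]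
      exact he
    · exact (hl h).1
  have hsum : m.sum (fun x c => c • x) = e + l.sum (fun x c => c • x) := by
    rw [hm, Finsupp.sum_add_index' (by simp) (by simp [add_smul]), Finsupp.sum_single_index
      (by simp), one_smul]
  have hHas : HasSum (fun x : E => m x • (x : V)) (e + l.sum fun x c => c • x) := by
    rw [← hsum]
    refine (hasSum_subtype_iff_of_support_subset (f := fun x : V => m x • x) (s := E) ?_).2
      (hasSum_sum_of_ne_finset_zero fun x hx => ?_)
    · intro x hx
      refine hmE (Finsupp.mem_support_iff.2 fun h0 => hx ?_)
      simp [h0]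
    · rw [Finsupp.notMem_support_iff.1 hx, zero_smul]
  have htend : Tendsto (fun x : E => m x) cofinite (𝓝 0) := by
    refine tendsto_nhds_of_eventually_eq ?_
    rw [Filter.eventually_cofinite]
    refine (m.support.finite_toSet.preimage Subtype.val_injective.injOn).subset fun x hx => ?_
    exact Finsupp.mem_support_iff.2 hx
  obtain ⟨s, hs, hsn⟩ := hE.norm_sum _ htend
  rw [hs.unique hHas] at hsn
  have hbdd : BddAbove (Set.range fun x : E => ‖m x‖) := by
    refine ⟨∑ x ∈ m.support, ‖m x‖, ?_⟩
    rintro _ ⟨x, rfl⟩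
    by_cases hx : (x : V) ∈ m.support
    · exact Finset.single_le_sum (f := fun x => ‖m x‖) (fun _ _ => norm_nonneg _) hx
    · simp only [Finsupp.notMem_support_iff.1 hx, norm_zero]
      exact Finset.sum_nonneg fun _ _ => norm_nonneg _
  have := le_ciSup hbdd ⟨e, he⟩
  rwa [← hsn, hme, norm_one] at this

theorem IsOrthonormalSchauderBasis.closedSpan_eq_top {E : Set V}
    (hE : IsOrthonormalSchauderBasis k E) : closedSpan (k := k) E = ⊤ := by
  refine eq_top_iff.2 fun x _ => ?_
  obtain ⟨c, -, hc⟩ := hE.exists_sum x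
  refine (isClosed_closedSpan (k := k) E).mem_of_tendsto hc (Eventually.of_forall fun F => ?_)
  exact Submodule.sum_mem _ fun e _ => Submodule.smul_mem _ _ (subset_closedSpan E e.2)

theorem IsOrthonormalSet.isOrthonormalSchauderBasis [IsUltrametricDist V] [CompleteSpace V]
    [CompleteSpace k] {T : Set V} (hT : IsOrthonormalSet k T)
    (htop : closedSpan (k := k) T = ⊤) : IsOrthonormalSchauderBasis k T where
  norm_eq_one e he := (hT e he).1
  norm_sum c hc := by
    obtain ⟨s, hs⟩ := hT.summable hc
    have hbdd : BddAbove (Set.range fun e : T => ‖c e‖) := hc.norm.bddAbove_range_of_cofinite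
    refine ⟨s, hs, le_antisymm ?_ ?_⟩
    · refine norm_le_of_hasSum hs (Real.iSup_nonneg fun _ => norm_nonneg _) fun e => ?_
      rw [norm_smul, (hT e e.2).1, mul_one]
      exact le_ciSup hbdd e
    · exact Real.iSup_le (hT.norm_le_hasSum hs) (norm_nonneg _)
  exists_sum x := hT.exists_hasSum (htop ▸ Submodule.mem_top)

theorem isFree_iff [IsUltrametricDist V] [CompleteSpace V] [CompleteSpace k] :
    IsFree k V ↔ ∃ T : Set V, IsOrthonormalSet k T ∧ closedSpan (k := k) T = ⊤ :=
  ⟨fun ⟨E, hE⟩ => ⟨E, hE.isOrthonormalSet, hE.closedSpan_eq_top⟩,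
    fun ⟨T, hT, h⟩ => ⟨T, hT.isOrthonormalSchauderBasis h⟩⟩

theorem isOrthonormalSet_image_val_iff {A : Submodule k V} {T : Set A} :
    IsOrthonormalSet k (Subtype.val '' T : Set V) ↔ IsOrthonormalSet k T := by
  have himg : ∀ e : A, (Subtype.val '' T : Set V) \ {(e : V)} = A.subtype '' (T \ {e}) := by
    intro e
    rw [Set.image_sdiff A.injective_subtype, Set.image_singleton]
    rfl
  constructor
  · intro h e he
    obtain ⟨h1, h2⟩ := h e ⟨e, he, rfl⟩
    refine ⟨h1, fun y hy => h2 y ?_⟩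
    rw [himg, ← Submodule.map_span]
    exact ⟨y, hy, rfl⟩
  · rintro h _ ⟨e, he, rfl⟩
    refine ⟨(h e he).1, fun y hy => ?_⟩
    rw [himg, ← Submodule.map_span] at hy
    obtain ⟨z, hz, rfl⟩ := hy
    exact (h e he).2 z hz

theorem mem_closedSpan_image_val_iff {A : Submodule k V} {T : Set A} {x : A} :
    (x : V) ∈ closedSpan (k := k) (Subtype.val '' T : Set V) ↔ x ∈ closedSpan (k := k) T := by
  have himg : Submodule.span k (Subtype.val '' T : Set V)
      = (Submodule.span k T).map A.subtype := by
    rw [Submodule.map_span]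
    rfl
  rw [mem_closedSpan_iff, mem_closedSpan_iff, himg]
  refine forall₂_congr fun ε _ => ⟨?_, ?_⟩
  · rintro ⟨_, ⟨z, hz, rfl⟩, h⟩
    exact ⟨z, hz, h⟩
  · rintro ⟨z, hz, h⟩
    exact ⟨z, ⟨z, hz, rfl⟩, h⟩

theorem IsCoordSystem.exists_orthonormal [IsUltrametricDist k] [IsUltrametricDist V]
    (hk : ∃ c : k, 1 < ‖c‖)
    {I : Type w} {φ : I → V →ₗ[k] k} {S : Set V}
    (h : IsCoordSystem φ ⊥ (closedSpan (k := k) S)) :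
    ∃ T : Set V, IsOrthonormalSet k T ∧ closedSpan (k := k) T = closedSpan (k := k) S := by
  obtain ⟨T, -, hT, hTB, hBT⟩ := h.exists_extend hk isOrthonormalSet_empty
    (Set.empty_subset _) bot_le
  exact ⟨T, hT, le_antisymm (closedSpan_le (isClosed_closedSpan S) hTB) hBT⟩

variable [IsUltrametricDist V] [CompleteSpace V] [CompleteSpace k]

theorem isFree_closedSpan_iff {S : Set V} :
    IsFree k (closedSpan (k := k) S) ↔
      ∃ T : Set V, IsOrthonormalSet k T ∧ closedSpan (k := k) T = closedSpan (k := k) S := by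
  have : CompleteSpace (closedSpan (k := k) S) :=
    (isClosed_closedSpan (k := k) S).completeSpace_coe
  rw [isFree_iff]
  constructor
  · rintro ⟨T, hT, htop⟩
    refine ⟨Subtype.val '' T, isOrthonormalSet_image_val_iff.2 hT, le_antisymm ?_ ?_⟩
    · refine closedSpan_le (isClosed_closedSpan S) ?_
      rintro _ ⟨t, -, rfl⟩
      exact t.2
    · intro x hx
      exact (mem_closedSpan_image_val_iff (x := ⟨x, hx⟩)).2 (htop ▸ Submodule.mem_top)
  · rintro ⟨T, hT, hTS⟩
    have himg : Subtype.val '' (Subtype.val ⁻¹' T : Set (closedSpan (k := k) S)) = T := by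
      refine Set.image_preimage_eq_of_subset fun t ht => ⟨⟨t, ?_⟩, rfl⟩
      exact hTS.le (subset_closedSpan T ht)
    refine ⟨Subtype.val ⁻¹' T, ?_, eq_top_iff.2 fun x _ => ?_⟩
    · rw [← isOrthonormalSet_image_val_iff, himg]
      exact hT
    · rw [← mem_closedSpan_image_val_iff, himg, hTS]
      exact x.2

theorem isRelSubfree_bot_of_isFree_closedSpan {S : Set V}
    (h : IsFree k (closedSpan (k := k) S)) : IsRelSubfree ⊥ (closedSpan (k := k) S) := by
  obtain ⟨T, hT, hTS⟩ := isFree_closedSpan_iff.1 h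
  have := isRelSubfree_of_subset hT (Set.empty_subset T)
  rwa [closedSpan_empty, hTS] at this

theorem isRelSubfree_bot_top_of_isFree (h : IsFree k V) :
    IsRelSubfree (⊥ : Submodule k V) ⊤ := by
  obtain ⟨T, hT, htop⟩ := isFree_iff.1 h
  have := isRelSubfree_of_subset hT (Set.empty_subset T)
  rwa [closedSpan_empty, htop] at this

theorem IsCoordSystem.isFree [IsUltrametricDist k] (hk : ∃ c : k, 1 < ‖c‖)
    {I : Type w} {φ : I → V →ₗ[k] k} (h : IsCoordSystem φ ⊥ (⊤ : Submodule k V)) :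
    IsFree k V := by
  obtain ⟨T, -, hT, -, hBT⟩ := h.exists_extend hk isOrthonormalSet_empty
    (Set.empty_subset _) bot_le
  exact isFree_iff.2 ⟨T, hT, eq_top_iff.2 hBT⟩

/-- Closed subspaces of free Banach spaces are free. -/
theorem IsFree.closedSpan [IsUltrametricDist k] (hk : ∃ c : k, 1 < ‖c‖) (h : IsFree k V)
    (S : Set V) : IsFree k (closedSpan (k := k) S) := by
  obtain ⟨I, φ, hφ⟩ := (isRelSubfree_bot_top_of_isFree h).restrict bot_le
    (le_top (a := UltraBanach.closedSpan (k := k) S))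
  exact isFree_closedSpan_iff.2 (hφ.exists_orthonormal hk)

end Free

/-! ### Trivially valued fields -/

section TrivialValuation

variable {k : Type u} [NormedField k] {V : Type v} [NormedAddCommGroup V] [NormedSpace k V]
  [IsUltrametricDist V] [CompleteSpace V] [CompleteSpace k]

/-- A nonzero coefficient has absolute value one, because its inverse is bounded by one as well. -/
theorem norm_eq_one_of_isFree (hk : ∀ c : k, ‖c‖ ≤ 1) (h : IsFree k V) {x : V} (hx : x ≠ 0) :
    ‖x‖ = 1 := by
  obtain ⟨T, hT, htop⟩ := isFree_iff.1 h
  obtain ⟨c, -, hc⟩ := hT.exists_hasSum (htop ▸ Submodule.mem_top : x ∈ closedSpan (k := k) T)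
  refine le_antisymm (norm_le_of_hasSum hc zero_le_one fun e => ?_) ?_
  · rw [norm_smul, (hT e e.2).1, mul_one]
    exact hk _
  · obtain ⟨e, he⟩ : ∃ e, c e ≠ 0 := by
      by_contra! h0
      simp only [h0, zero_smul] at hc
      exact hx (hc.unique hasSum_zero)
    refine le_trans ?_ (hT.norm_le_hasSum hc e)
    have := hk (c e)⁻¹
    rw [norm_inv] at this
    exact (inv_le_one₀ (norm_pos_iff.2 he)).1 this

/-- Any algebraic basis is orthonormal here. -/
theorem isFree_of_norm_eq_one (h : ∀ x : V, x ≠ 0 → ‖x‖ = 1) : IsFree k V := by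
  refine isFree_iff.2 ⟨Module.Basis.ofVectorSpaceIndex k V, fun e he => ?_, ?_⟩
  · have hli := Module.Basis.ofVectorSpaceIndex.linearIndependent k V
    refine ⟨h e (hli.ne_zero ⟨e, he⟩), fun y hy => (h _ fun h0 => ?_).ge⟩
    have hey : e ∈ Submodule.span k (Module.Basis.ofVectorSpaceIndex k V \ {e}) := by
      have := Submodule.neg_mem _ hy
      rwa [← eq_neg_of_add_eq_zero_left h0] at this
    have := hli.notMem_span_image (s := {⟨e, he⟩}ᶜ) (x := ⟨e, he⟩) (by simp)
    refine this ?_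
    convert hey using 2
    ext z
    simp only [Set.mem_image, Set.mem_compl_iff, Set.mem_singleton_iff, Subtype.exists,
      Set.mem_sdiff]
    constructor
    · rintro ⟨a, ha, hne, rfl⟩
      exact ⟨ha, fun hh => hne (Subtype.ext hh)⟩
    · rintro ⟨hz, hne⟩
      exact ⟨z, hz, fun hh => hne (congrArg Subtype.val hh), rfl⟩
  · refine eq_top_iff.2 (le_trans ?_ (span_le_closedSpan _))
    have := (Module.Basis.ofVectorSpace k V).span_eq
    rw [Module.Basis.range_ofVectorSpace] at this
    rw [this]

theorem isFree_iff_isAlmostFree_of_trivial (hk : ∀ c : k, ‖c‖ ≤ 1) (hrank : 1 < rank k V) :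
    IsFree k V ↔ IsAlmostFree k V := by
  have hcomp : ∀ S : Set V, CompleteSpace (closedSpan (k := k) S) := fun S =>
    (isClosed_closedSpan (k := k) S).completeSpace_coe
  constructor
  · intro h S _
    have := hcomp S
    refine isFree_of_norm_eq_one fun x hx => ?_
    exact norm_eq_one_of_isFree (k := k) hk h (x := (x : V)) (by simpa using hx)
  · intro h
    refine isFree_of_norm_eq_one fun x hx => ?_
    have := hcomp {x}
    have hfree := h {x} (by rwa [Cardinal.mk_singleton])
    have hx' : x ∈ closedSpan (k := k) {x} := subset_closedSpan _ rfl
    exact norm_eq_one_of_isFree hk hfree (x := ⟨x, hx'⟩) (by simpa using hx)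

end TrivialValuation

/-! ### Regular rank: ultraproducts of free spaces -/

section Ultraproduct

theorem mk_Iio_toType_lt {c : Cardinal.{v}} (a : c.ord.ToType) : #(Set.Iio a) < c := by
  simpa using Cardinal.mk_Iio_lt a (by simp)

theorem mk_Iic_toType_lt {c : Cardinal.{v}} (hc : ℵ₀ ≤ c) (a : c.ord.ToType) :
    #(Set.Iic a) < c := by
  rw [← Set.Iio_insert]
  exact Cardinal.mk_insert_le.trans_lt
    (Cardinal.add_lt_of_lt hc (mk_Iio_toType_lt a) (Cardinal.one_lt_aleph0.trans_le hc))

/-- Otherwise the fewer than c sets where g differs from a given y all lie in U, yet have empty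
intersection. -/
theorem eventually_eq_const_of_cardinalInterFilter {X : Type w} {Y : Type v} {U : Ultrafilter X}
    {c : Cardinal.{w}} (hU : CardinalInterFilter (U : Filter X) c)
    (hY : Cardinal.lift.{w} #Y < Cardinal.lift.{v} c) (g : X → Y) :
    ∃ y, ∀ᶠ x in (U : Filter X), g x = y := by
  by_contra! h
  have hmem : ∀ s ∈ Set.range fun y : Y => {x | g x ≠ y}, s ∈ (U : Filter X) := by
    rintro _ ⟨y, rfl⟩
    exact h y
  have hcard : #(Set.range fun y : Y => {x | g x ≠ y}) < c := by
    rw [← Cardinal.lift_lt.{w, v}]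
    exact Cardinal.mk_range_le_lift.trans_lt hY
  obtain ⟨x, hx⟩ := U.neBot.nonempty_of_mem (hU.cardinal_sInter_mem _ hcard hmem)
  exact hx _ ⟨g x, rfl⟩ rfl

variable {k : Type u} [NormedField k] {V : Type v} [NormedAddCommGroup V] [NormedSpace k V]

/-- The coordinates of a subspace of a free space, with a zero coordinate added if necessary. -/
theorem IsRelSubfree.exists_coord_attained {B : Submodule k V} (h : IsRelSubfree ⊥ B) :
    ∃ (I : Type v) (φ : I → V →ₗ[k] k), ∀ b ∈ B, (∀ ε > 0, {i | ε ≤ ‖φ i b‖}.Finite) ∧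
      (∀ i, ‖φ i b‖ ≤ ‖b‖) ∧ ∃ i, ‖φ i b‖ = ‖b‖ := by
  obtain ⟨I, φ, h⟩ := h
  refine ⟨Option I, fun o => o.elim 0 φ, fun b hb => ⟨fun ε hε => ?_, ?_, ?_⟩⟩
  · refine ((h.finite b hb ε hε).image some).subset ?_
    rintro (_ | i) hi
    · exact absurd hi (by simpa using hε)
    · exact ⟨i, hi, rfl⟩
  · rintro (_ | i)
    · simp
    · exact h.norm_le b hb i
  · obtain ⟨a, ha, hle⟩ := h.exists_norm_sub_le b hb
    rw [Submodule.mem_bot] at ha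
    subst ha
    rw [sub_zero] at hle
    rcases eq_zero_or_exists_norm_max (h.finite b hb) Set.univ with h0 | ⟨i, -, -, hi⟩
    · refine ⟨none, ?_⟩
      have := hle 0 le_rfl fun i => by rw [h0 i trivial, norm_zero]
      rw [norm_le_zero_iff] at this
      simp [this]
    · exact ⟨some i, le_antisymm (h.norm_le b hb i)
        (hle _ (norm_nonneg _) fun j => hi j trivial)⟩

variable [IsUltrametricDist k]

/-- Dilation by c identifies k / O_k with k / cO_k, so g is almost everywhere constant modulo cO_k
for arbitrarily small c, hence Cauchy along U. This is why the size of k / O_k governs λ_k. -/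
theorem exists_tendsto_ultrafilter [CompleteSpace k] (hk : ∃ c : k, 1 < ‖c‖) {X : Type w}
    {U : Ultrafilter X} (hU : ∀ g : X → k ⧸ integers k, ∃ y, ∀ᶠ x in (U : Filter X), g x = y)
    (g : X → k) : ∃ a, Tendsto g U (𝓝 a) := by
  refine CompleteSpace.complete (Metric.cauchy_iff.2 ⟨inferInstance, fun ε hε => ?_⟩)
  obtain ⟨c, hc0, hc⟩ := exists_norm_lt_of_one_lt hk hε
  obtain ⟨y, hy⟩ := hU fun x => (QuotientAddGroup.mk (c⁻¹ * g x) : k ⧸ integers k)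
  refine ⟨g '' {x | (QuotientAddGroup.mk (c⁻¹ * g x) : k ⧸ integers k) = y},
    image_mem_map hy, ?_⟩
  rintro _ ⟨x, hx, rfl⟩ _ ⟨x', hx', rfl⟩
  rw [Set.mem_ofPred_eq] at hx hx'
  have h1 : ‖-(c⁻¹ * g x') + c⁻¹ * g x‖ ≤ 1 := QuotientAddGroup.eq.1 (hx'.trans hx.symm)
  rw [dist_eq_norm]
  have h2 : g x - g x' = c * (-(c⁻¹ * g x') + c⁻¹ * g x) := by
    field_simp
    ring
  rw [h2, norm_mul]
  exact (mul_le_of_le_one_right (norm_nonneg _) h1).trans_lt hc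

/-- A space which is almost everywhere covered by subspaces of free spaces embeds into an
ultraproduct of free spaces. -/
theorem exists_isCoordSystem_of_ultrafilter [CompleteSpace k] (hk : ∃ c : k, 1 < ‖c‖)
    {X : Type w} {U : Ultrafilter X}
    (hU : ∀ g : X → k ⧸ integers k, ∃ y, ∀ᶠ x in (U : Filter X), g x = y)
    (hUn : ∀ g : X → ℕ, ∃ y, ∀ᶠ x in (U : Filter X), g x = y)
    (B : X → Submodule k V) (hB : ∀ x, IsRelSubfree ⊥ (B x))
    (hmem : ∀ v, ∀ᶠ x in (U : Filter X), v ∈ B x) :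
    ∃ (I : Type (max v w)) (φ : I → V →ₗ[k] k), IsCoordSystem φ ⊥ ⊤ := by
  classical
  choose I φ hφ using fun x => (hB x).exists_coord_attained
  choose L hL using fun (f : ∀ x, I x) (v : V) =>
    exists_tendsto_ultrafilter hk hU fun x => φ x (f x) v
  let ψ : (U : Filter X).Product I → V →ₗ[k] k := fun q =>
    { toFun := L q.out
      map_add' := fun v v' => tendsto_nhds_unique (hL _ _)
        (((hL q.out v).add (hL q.out v')).congr fun x => (map_add _ _ _).symm)
      map_smul' := fun c v => tendsto_nhds_unique (hL _ _)
        (((hL q.out v).const_smul c).congr fun x => (map_smul _ _ _).symm) }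
  have hψ : ∀ q v, Tendsto (fun x => ‖φ x (q.out x) v‖) U (𝓝 ‖ψ q v‖) :=
    fun q v => (hL q.out v).norm
  refine ⟨_, ψ, bot_le, fun v _ ε hε => ?_, fun v _ q => ?_, ?_, fun v _ => ?_⟩
  -- With infinitely many limits of size at least ε, some m + 1 of them have representatives that
  -- are distinct and of size at least ε/2 at a common x, where only m coordinates are that large.
  · by_contra hinf
    obtain ⟨m, hm⟩ := hUn fun x => {i | ε / 2 ≤ ‖φ x i v‖}.ncard
    obtain ⟨s, hs, hsm⟩ := Set.Infinite.exists_subset_card_eq hinf (m + 1)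
    have h1 : ∀ᶠ x in (U : Filter X), ∀ q ∈ s, ε / 2 ≤ ‖φ x (q.out x) v‖ := by
      rw [Filter.eventually_all_finset]
      intro q hq
      exact ((hψ q v).eventually_const_lt ((half_lt_self hε).trans_le (hs hq))).mono
        fun _ h => h.le
    have h2 : ∀ᶠ x in (U : Filter X), ∀ q ∈ s, ∀ q' ∈ s, q.out x = q'.out x → q = q' := by
      rw [Filter.eventually_all_finset]
      intro q _
      rw [Filter.eventually_all_finset]
      intro q' _
      by_cases hqq : q = q'
      · exact Eventually.of_forall fun _ _ => hqq
      · have : ¬ ∀ᶠ x in (U : Filter X), q.out x = q'.out x := fun h => hqq (by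
          rw [← q.out_eq, ← q'.out_eq]
          exact Quotient.sound h)
        exact (Ultrafilter.eventually_not.2 this).mono fun x hx h => absurd h hx
    obtain ⟨x, hx, hx1, hx2, hxm⟩ := (hm.and (h1.and (h2.and (hmem v)))).exists
    have hfin := (hφ x v hxm).1 (ε / 2) (half_pos hε)
    have hle := Set.ncard_le_ncard (s := ((s.image fun q => q.out x : Finset (I x)) : Set (I x)))
      (t := {i | ε / 2 ≤ ‖φ x i v‖}) (by
        intro i hi
        obtain ⟨q, hq, rfl⟩ := Finset.mem_image.1 hi
        exact hx1 q hq) hfin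
    rw [Set.ncard_coe_finset, Finset.card_image_of_injOn fun q hq q' hq' h => hx2 q hq q' hq' h,
      hsm, hx] at hle
    omega
  · exact le_of_tendsto (hψ q v) ((hmem v).mono fun x hx => (hφ x v hx).2.1 _)
  · intro a ha q
    rw [(Submodule.mem_bot k).1 ha, map_zero]
  · refine ⟨0, Submodule.zero_mem _, fun r _ hle => ?_⟩
    have hne : ∀ x, Nonempty (I x) := fun x =>
      ⟨((hφ x 0 (Submodule.zero_mem _)).2.2).choose⟩
    -- This section picks a coordinate attaining the norm of v, so its limit has absolute value
    -- equal to that norm.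
    let f : ∀ x, I x := fun x =>
      if h : v ∈ B x then (hφ x v h).2.2.choose else (hne x).some
    have hf : ∀ x, v ∈ B x → ‖φ x (f x) v‖ = ‖v‖ := fun x hx => by
      simp only [f, dif_pos hx]
      exact (hφ x v hx).2.2.choose_spec
    let q : (U : Filter X).Product I := Quotient.mk (productSetoid _ _) f
    have hq : ∀ᶠ x in (U : Filter X), q.out x = f x := Quotient.mk_out (s := productSetoid _ _) f
    have hlim : Tendsto (fun x => ‖φ x (q.out x) v‖) U (𝓝 ‖v‖) := by
      refine tendsto_nhds_of_eventually_eq ?_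
      filter_upwards [hq, hmem v] with x hx hxv
      rw [hx, hf x hxv]
    rw [sub_zero, ← tendsto_nhds_unique (hψ q v) hlim]
    exact hle q

/-- Regularity makes the cocardinal filter complete enough for strong compactness to apply; each v
lies in all but fewer than κ initial segments. -/
theorem isFree_of_isAlmostFree_of_isRegular [IsUltrametricDist V] [CompleteSpace V]
    [CompleteSpace k] (hk : ∃ c : k, 1 < ‖c‖) (hcard : #V = rank k V)
    (hcompact : IsStronglyCompactCard
      (Cardinal.lift.{v} (lambdaCard k)) (Cardinal.lift.{u} (rank k V)))
    (hreg : (rank k V).IsRegular) (h : IsAlmostFree k V) : IsFree k V := by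
  have hX : #(ULift.{u} V) = Cardinal.lift.{u} (rank k V) := by rw [Cardinal.mk_uLift, hcard]
  have hreg' : (Cardinal.lift.{u} (rank k V)).IsRegular := hreg.lift
  obtain ⟨U, hU, hUle⟩ := hcompact.2 (ULift.{u} V) hX (cocardinal _ hreg') (by
    rw [neBot_iff, Ne, ← empty_mem_iff_bot, mem_cocardinal, Set.compl_empty, mk_univ, hX]
    exact lt_irrefl _) inferInstance
  have hlam : ∀ c : Cardinal.{u}, c ≤ max #(k ⧸ integers k) ℵ₀ → c < lambdaCard k :=
    fun c hc => Order.lt_succ_of_le hc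
  obtain ⟨e⟩ : Nonempty (V ≃ (rank k V).ord.ToType) := by
    rw [← Cardinal.eq, mk_ord_toType, hcard]
  have hIio : ∀ a : (rank k V).ord.ToType, #(e ⁻¹' Set.Iio a) < rank k V := fun a =>
    (mk_preimage_of_injective _ _ e.injective).trans_lt (mk_Iio_toType_lt a)
  have hco : ∀ v, {x : ULift.{u} V | v ∈ e ⁻¹' Set.Iio (e x.down)} ∈ cocardinal _ hreg' := by
    intro v
    rw [mem_cocardinal]
    have hsub : {x : ULift.{u} V | v ∈ e ⁻¹' Set.Iio (e x.down)}ᶜ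
        ⊆ (fun x : ULift.{u} V => e x.down) ⁻¹' Set.Iic (e v) := fun x hx =>
      (not_lt (a := e v) (b := e x.down)).1 hx
    refine (mk_le_mk_of_subset hsub).trans_lt ?_
    rw [← Cardinal.lift_lt.{max u v, v}]
    refine (mk_preimage_of_injective_lift _ _ (e.injective.comp ULift.down_injective)).trans_lt ?_
    have := Cardinal.lift_lt.{v, u}.2 (mk_Iic_toType_lt hreg.aleph0_le (e v))
    simpa using this
  obtain ⟨I, φ, hφ⟩ := exists_isCoordSystem_of_ultrafilter hk (U := U)
    (eventually_eq_const_of_cardinalInterFilter hU (by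
      simp only [Cardinal.lift_lift]
      rw [Cardinal.lift_umax.{u, v}]
      exact Cardinal.lift_lt.2 (hlam _ (le_max_left _ _))))
    (eventually_eq_const_of_cardinalInterFilter hU (by
      simp only [mk_nat, Cardinal.lift_aleph0]
      rw [← Cardinal.lift_aleph0.{v, u}]
      simpa using hlam _ (le_max_right _ _)))
    (fun x => closedSpan (k := k) (e ⁻¹' Set.Iio (e x.down)))
    (fun x => isRelSubfree_bot_of_isFree_closedSpan (h _ (hIio _)))
    (fun v => Filter.mem_of_superset (hUle (hco v)) fun x hx => subset_closedSpan _ hx)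
  exact hφ.isFree hk

end Ultraproduct

/-! ### Singular rank: Shelah's compactness argument -/

section Singular

theorem mk_biUnion_le_of_forall_le {ι V : Type v} {ν : Cardinal.{v}} (hν : ℵ₀ ≤ ν) {s : Set ι}
    (hs : #s ≤ ν) {A : ι → Set V} (hA : ∀ i ∈ s, #(A i) ≤ ν) : #(⋃ i ∈ s, A i) ≤ ν :=
  (mk_biUnion_le A s).trans ((mul_le_mul' hs (ciSup_le' fun i : s => hA i i.2)).trans
    (mul_eq_self hν).le)

theorem mk_union_le_of_le {V : Type v} {ν : Cardinal.{v}} (hν : ℵ₀ ≤ ν) {S T : Set V}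
    (hS : #S ≤ ν) (hT : #T ≤ ν) : #(S ∪ T : Set V) ≤ ν :=
  (mk_union_le S T).trans (add_le_of_le hν hS hT)

variable {k : Type u} [NormedField k] {V : Type v} [NormedAddCommGroup V] [NormedSpace k V]

variable (k) in
/-- Countably many elements of `T` whose closed span contains `x`, if `T` has such elements. -/
noncomputable def spanSupport (T : Set V) (x : V) : Set V :=
  open Classical in
  if h : x ∈ closedSpan (k := k) T then (exists_countable_mem_closedSpan h).choose else ∅

theorem spanSupport_subset (T : Set V) (x : V) : spanSupport k T x ⊆ T := by
  unfold spanSupport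
  split_ifs with h
  · exact (exists_countable_mem_closedSpan h).choose_spec.1
  · exact Set.empty_subset T

theorem mk_spanSupport_le {ν : Cardinal.{v}} (hν : ℵ₀ ≤ ν) (T : Set V) (x : V) :
    #(spanSupport k T x) ≤ ν := by
  refine le_trans (Cardinal.le_aleph0_iff_set_countable.2 ?_) hν
  unfold spanSupport
  split_ifs with h
  · exact (exists_countable_mem_closedSpan h).choose_spec.2.1
  · exact Set.countable_empty

theorem mem_closedSpan_spanSupport {T : Set V} {x : V} (h : x ∈ closedSpan (k := k) T) :
    x ∈ closedSpan (k := k) (spanSupport k T x) := by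
  unfold spanSupport
  rw [dif_pos h]
  exact (exists_countable_mem_closedSpan h).choose_spec.2.2

variable [IsUltrametricDist V]

theorem IsOrthonormalSet.mem_of_mem_closedSpan {T T₁ : Set V} (hT : IsOrthonormalSet k T)
    (h₁ : T₁ ⊆ T) {e : V} (he : e ∈ T) (h : e ∈ closedSpan (k := k) T₁) : e ∈ T₁ := by
  by_contra hcon
  have := hT.norm_le_add h₁ (Set.singleton_subset_iff.2 he)
    (Set.disjoint_singleton_right.2 hcon) (Submodule.neg_mem _ h)
    (Submodule.mem_span_singleton_self e)
  rw [neg_add_cancel, norm_zero, (hT e he).1] at this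
  exact absurd this (not_le.2 one_pos)

/-- Each vector of S uses countably many vectors of T, and these exhaust T because no vector of T
lies in the closed span of the others. -/
theorem IsOrthonormalSet.mk_le {ν : Cardinal.{v}} (hν : ℵ₀ ≤ ν) {T S : Set V}
    (hT : IsOrthonormalSet k T) (hTS : closedSpan (k := k) T = closedSpan (k := k) S)
    (hS : #S ≤ ν) : #T ≤ ν := by
  have hsub : (⋃ s ∈ S, spanSupport k T s) ⊆ T :=
    Set.iUnion₂_subset fun s _ => spanSupport_subset T s
  have hle : T ⊆ ⋃ s ∈ S, spanSupport k T s := by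
    refine fun t ht => hT.mem_of_mem_closedSpan hsub ht ?_
    have hS' : S ⊆ closedSpan (k := k) (⋃ s ∈ S, spanSupport k T s) := fun s hs =>
      closedSpan_mono (Set.subset_biUnion_of_mem (u := fun s => spanSupport k T s) hs)
        (mem_closedSpan_spanSupport (hTS.ge (subset_closedSpan S hs)))
    exact closedSpan_le_closedSpan hS' (hTS.le (subset_closedSpan T ht))
  exact (mk_le_mk_of_subset hle).trans
    (mk_biUnion_le_of_forall_le hν hS fun s _ => mk_spanSupport_le hν T s)

/-- The union of a family of orthonormal sets, each of which splits over the previous ones, spans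
a free space. -/
theorem exists_orthonormal_of_filtration {ι : Type w} [LinearOrder ι] [WellFoundedLT ι]
    {B : ι → Set V} (hB : ∀ i, IsOrthonormalSet k (B i))
    (hsplit : ∀ i j, i < j → B i ⊆ closedSpan (k := k) (B j ∩ closedSpan (k := k) (B i))) :
    ∃ D : Set V, IsOrthonormalSet k D ∧ ∀ i, B i ⊆ closedSpan (k := k) D := by
  -- Only the part of B j not yet reached is kept. By splitting, the earlier D i lie in the closed
  -- span of the rest of B j, hence are orthogonal to D j; no continuity of the filtration is
  -- needed.
  let D : ι → Set V := fun j => B j \ ⋃ i ∈ Set.Iio j, (closedSpan (k := k) (B i) : Set V)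
  have hDB : ∀ j, D j ⊆ B j := fun j => Set.sdiff_subset
  have hdir : ∀ f : ι → Set ι, Monotone f → ∀ s : Set ι,
      DirectedOn (· ⊆ ·) ((fun i => ⋃ j ∈ f i, D j) '' s) := by
    intro f hf s
    have hmono : Monotone fun i => ⋃ j ∈ f i, D j := fun i j hij =>
      Set.biUnion_subset_biUnion_left (hf hij)
    rintro _ ⟨i, hi, rfl⟩ _ ⟨j, hj, rfl⟩
    rcases le_total i j with hij | hij
    · exact ⟨_, ⟨j, hj, rfl⟩, hmono hij, subset_rfl⟩
    · exact ⟨_, ⟨i, hi, rfl⟩, subset_rfl, hmono hij⟩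
  have hIic : Monotone (Set.Iic : ι → Set ι) := fun _ _ h => Set.Iic_subset_Iic.2 h
  have horth : ∀ j, IsOrthonormalSet k (⋃ i ∈ Set.Iic j, D i) := by
    intro j
    induction j using WellFoundedLT.induction with
    | ind j ih =>
      have hP : IsOrthonormalSet k (⋃ i ∈ Set.Iio j, D i) := by
        refine (isOrthonormalSet_sUnion (hdir Set.Iic hIic (Set.Iio j)) ?_).mono ?_
        · rintro _ ⟨i, hi, rfl⟩
          exact ih i hi
        · exact Set.iUnion₂_subset fun i hi x hx =>
            ⟨_, ⟨i, hi, rfl⟩, Set.mem_biUnion (Set.mem_Iic.2 le_rfl) hx⟩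
      rw [← Set.Iio_insert, Set.biUnion_insert, Set.union_comm]
      refine hP.union ((hB j).mono (hDB j)) fun y hy z hz => ?_
      have hsub : (⋃ i ∈ Set.Iio j, D i) ⊆ closedSpan (k := k)
          (B j ∩ ⋃ i ∈ Set.Iio j, (closedSpan (k := k) (B i) : Set V)) := by
        refine Set.iUnion₂_subset fun i hi x hx => ?_
        refine closedSpan_mono ?_ (hsplit i j hi (hDB i hx))
        exact Set.inter_subset_inter_right _
          (Set.subset_biUnion_of_mem (u := fun i => (closedSpan (k := k) (B i) : Set V)) hi)
      refine (hB j).norm_le_add Set.inter_subset_left (hDB j) ?_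
        (Submodule.span_le.2 hsub hy) hz
      exact Set.disjoint_left.2 fun x hx hx' => hx'.2 hx.2
  refine ⟨⋃ j, D j, ?_, fun j => ?_⟩
  · refine (isOrthonormalSet_sUnion (hdir Set.Iic hIic Set.univ) ?_).mono ?_
    · rintro _ ⟨i, -, rfl⟩
      exact horth i
    · exact Set.iUnion_subset fun i x hx =>
        ⟨_, ⟨i, trivial, rfl⟩, Set.mem_biUnion (Set.mem_Iic.2 le_rfl) hx⟩
  · induction j using WellFoundedLT.induction with
    | ind j ih =>
      intro x hx
      by_cases hxj : x ∈ ⋃ i ∈ Set.Iio j, (closedSpan (k := k) (B i) : Set V)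
      · obtain ⟨i, hi, hxi⟩ := Set.mem_iUnion₂.1 hxj
        exact closedSpan_le_closedSpan (ih i hi) hxi
      · exact subset_closedSpan _ (Set.mem_iUnion.2 ⟨j, hx, hxj⟩)

variable [CompleteSpace V] [CompleteSpace k]

/-- If all subspaces of rank at most `ν⁺` are free, every set of cardinality at most `ν` is
contained in one modulo which all subspaces of rank at most `ν` are embeddable into free ones. -/
theorem exists_saturated_superset {ν : Cardinal.{v}} (hν : ℵ₀ ≤ ν)
    (hfree : ∀ S : Set V, #S ≤ Order.succ ν → IsFree k (closedSpan (k := k) S))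
    {X₀ : Set V} (hX₀ : #X₀ ≤ ν) :
    ∃ S : Set V, X₀ ⊆ S ∧ #S ≤ ν ∧ ∀ X : Set V, #X ≤ ν →
      IsRelSubfree (closedSpan (k := k) S) (closedSpan (k := k) (S ∪ X)) := by
  -- Otherwise a chain of length ν⁺ is built in which each S a is followed by sets containing a
  -- counterexample `W (S a)`. Its union generates a free space.
  by_contra! H
  have hW : ∀ S : Set V, ∃ X : Set V, #X ≤ ν ∧ (X₀ ⊆ S → #S ≤ ν →
      ¬ IsRelSubfree (closedSpan (k := k) S) (closedSpan (k := k) (S ∪ X))) := by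
    intro S
    by_cases hS : X₀ ⊆ S ∧ #S ≤ ν
    · obtain ⟨X, hX, hn⟩ := H S hS.1 hS.2
      exact ⟨X, hX, fun _ _ => hn⟩
    · exact ⟨∅, by simp, fun h1 h2 => absurd ⟨h1, h2⟩ hS⟩
  choose W hWν hW using hW
  let Ω := (Order.succ ν).ord.ToType
  have hbound : ∀ s : Set Ω, #s ≤ ν → ∃ b, ∀ x ∈ s, x < b := by
    intro s hs
    by_contra! hcon
    have h1 : Order.cof Ω ≤ #s := Order.cof_le fun a => hcon a
    rw [Ordinal.cof_toType, (isRegular_succ hν).cof_ord] at h1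
    exact absurd (h1.trans hs) (not_le.2 (Order.lt_succ ν))
  let S : Ω → Set V := wellFounded_lt.fix fun a F => X₀ ∪ ⋃ b : Set.Iio a, W (F b b.2)
  have hS : ∀ a, S a = X₀ ∪ ⋃ b ∈ Set.Iio a, W (S b) := fun a => by
    rw [Set.biUnion_eq_iUnion]
    exact WellFounded.fix_eq _ _ a
  have hX₀S : ∀ a, X₀ ⊆ S a := fun a => by rw [hS]; exact Set.subset_union_left
  have hmono : Monotone S := fun a b hab => by
    rw [hS a, hS b]
    exact Set.union_subset_union_right _
      (Set.biUnion_subset_biUnion_left (Set.Iio_subset_Iio hab))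
  have hWS : ∀ a b, a < b → W (S a) ⊆ S b := fun a b hab => by
    rw [hS b]
    exact (Set.subset_biUnion_of_mem (s := Set.Iio b) (u := fun b => W (S b)) hab).trans
      Set.subset_union_right
  have hSν : ∀ a, #(S a) ≤ ν := fun a => by
    rw [hS]
    exact mk_union_le_of_le hν hX₀ (mk_biUnion_le_of_forall_le hν
      (Order.lt_succ_iff.1 (mk_Iio_toType_lt a)) fun b _ => hWν _)
  have hunion : #(⋃ a, S a) ≤ Order.succ ν := by
    rw [← Set.biUnion_univ]
    refine mk_biUnion_le_of_forall_le (hν.trans (Order.le_succ ν)) ?_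
      fun a _ => (hSν a).trans (Order.le_succ ν)
    rw [mk_univ]
    exact (mk_ord_toType _).le
  obtain ⟨T, hT, hTS⟩ := isFree_closedSpan_iff.1 (hfree _ hunion)
  have hSsub : ∀ a, S a ⊆ ⋃ a, S a := Set.subset_iUnion S
  -- Back and forth: P a is a part of the basis T whose closed span contains S a, and R a is a part
  -- of the union of the chain whose closed span contains P a.
  let P : Ω → Set V := fun a => ⋃ s ∈ S a, spanSupport k T s
  let R : Ω → Set V := fun a => ⋃ t ∈ P a, spanSupport k (⋃ a, S a) t
  have hPT : ∀ a, P a ⊆ T := fun a => Set.iUnion₂_subset fun s _ => spanSupport_subset T s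
  have hRν : ∀ a, #(R a) ≤ ν := fun a =>
    mk_biUnion_le_of_forall_le hν (mk_biUnion_le_of_forall_le hν (hSν a)
      fun s _ => mk_spanSupport_le hν T s) fun t _ => mk_spanSupport_le hν _ t
  have hg : ∀ a, ∃ b, a < b ∧ R a ⊆ S b := by
    intro a
    have hRS : ∀ r : R a, ∃ b, (r : V) ∈ S b := by
      rintro ⟨r, hr⟩
      obtain ⟨t, -, hrt⟩ := Set.mem_iUnion₂.1 hr
      exact Set.mem_iUnion.1 (spanSupport_subset _ t hrt)
    choose β hβ using hRS
    obtain ⟨b, hb⟩ := hbound (insert a (Set.range β))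
      (mk_insert_le.trans (add_le_of_le hν (mk_range_le.trans (hRν a))
        (one_le_aleph0.trans hν)))
    exact ⟨b, hb a (Set.mem_insert _ _), fun r hr =>
      hmono (hb _ (Set.mem_insert_of_mem _ ⟨⟨r, hr⟩, rfl⟩)).le (hβ ⟨r, hr⟩)⟩
  choose g hag hRg using hg
  obtain ⟨a₀, -⟩ := hbound ∅ (by simp)
  let a : ℕ → Ω := fun n => g^[n] a₀
  have ha : ∀ n, a (n + 1) = g (a n) := fun n => Function.iterate_succ_apply' g n a₀
  obtain ⟨b₀, hb₀⟩ := hbound (Set.range a)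
    ((Cardinal.le_aleph0_iff_set_countable.2 (Set.countable_range a)).trans hν)
  have hne : {b | ∀ n, a n < b}.Nonempty := ⟨b₀, fun n => hb₀ _ ⟨n, rfl⟩⟩
  -- Minimality makes S b the union of the S (a n), so its closed span is that of a subset of T.
  -- Over it the whole union is embeddable, contrary to the choice of `W (S b)`.
  let b := wellFounded_lt.min _ hne
  have hab : ∀ n, a n < b := wellFounded_lt.min_mem _ hne
  have hSb : S b = ⋃ n, S (a n) := by
    refine subset_antisymm ?_ (Set.iUnion_subset fun n => hmono (hab n).le)
    intro s hs
    rw [hS] at hs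
    rcases hs with hs | hs
    · exact Set.mem_iUnion.2 ⟨0, hX₀S _ hs⟩
    · obtain ⟨c, hc, hs⟩ := Set.mem_iUnion₂.1 hs
      have hc' : ¬ ∀ n, a n < c := fun hcon => wellFounded_lt.not_lt_min {b | ∀ n, a n < b} hcon hc
      push Not at hc'
      obtain ⟨n, hn⟩ := hc'
      refine Set.mem_iUnion.2 ⟨n + 1, hWS c _ ?_ hs⟩
      rw [ha]
      exact hn.trans_lt (hag _)
  have hspan : closedSpan (k := k) (⋃ n, P (a n)) = closedSpan (k := k) (S b) := by
    refine le_antisymm (closedSpan_le_closedSpan (Set.iUnion_subset fun n t ht => ?_))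
      (closedSpan_le_closedSpan fun s hs => ?_)
    · have h1 : t ∈ closedSpan (k := k) (⋃ a, S a) := hTS.le (subset_closedSpan T (hPT _ ht))
      refine closedSpan_mono ?_ (mem_closedSpan_spanSupport h1)
      have h2 : spanSupport k (⋃ a, S a) t ⊆ R (a n) :=
        Set.subset_biUnion_of_mem (u := fun t => spanSupport k (⋃ a, S a) t) ht
      refine h2.trans ((hRg (a n)).trans ?_)
      rw [← ha]
      exact hmono (hab _).le
    · rw [hSb] at hs
      obtain ⟨n, hn⟩ := Set.mem_iUnion.1 hs
      have h1 : s ∈ closedSpan (k := k) T := hTS.ge (subset_closedSpan _ (hSsub _ hn))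
      refine closedSpan_mono ?_ (mem_closedSpan_spanSupport h1)
      exact (Set.subset_biUnion_of_mem (u := fun s => spanSupport k T s) hn).trans
        (Set.subset_iUnion (fun n => P (a n)) n)
  have hrel := isRelSubfree_of_subset hT (Set.iUnion_subset fun n => hPT (a n))
  rw [hspan, hTS] at hrel
  exact hW (S b) (hX₀S b) (hSν b) (hrel.restrict (closedSpan_mono Set.subset_union_left)
    (closedSpan_mono (Set.union_subset (hSsub b) ((hWS b _ (hag b)).trans (hSsub _)))))

variable (k) in
/-- An orthonormal set of cardinality at most `ν`, modulo which all subspaces of rank at most `ν`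
are embeddable into free ones. -/
structure IsSaturated (ν : Cardinal.{v}) (B : Set V) : Prop where
  orthonormal : IsOrthonormalSet k B
  mk_le : #B ≤ ν
  isRelSubfree : ∀ X : Set V, #X ≤ ν →
    IsRelSubfree (closedSpan (k := k) B) (closedSpan (k := k) (B ∪ X))

theorem isSaturated_empty {ν : Cardinal.{v}}
    (hfree : ∀ S : Set V, #S ≤ Order.succ ν → IsFree k (closedSpan (k := k) S)) :
    IsSaturated k ν (∅ : Set V) where
  orthonormal := isOrthonormalSet_empty
  mk_le := by simp
  isRelSubfree X hX := by
    rw [closedSpan_empty, Set.empty_union]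
    exact isRelSubfree_bot_of_isFree_closedSpan (hfree X (hX.trans (Order.le_succ ν)))

/-- Embeddability depends only on closed spans, so saturation passes from a set S to any orthonormal
basis of its closed span; the relative Gruson theorem finds one containing B. -/
theorem IsSaturated.exists_extend [IsUltrametricDist k] (hk : ∃ c : k, 1 < ‖c‖)
    {ν : Cardinal.{v}} (hν : ℵ₀ ≤ ν)
    (hfree : ∀ S : Set V, #S ≤ Order.succ ν → IsFree k (closedSpan (k := k) S))
    {B : Set V} (hB : IsSaturated k ν B) {X : Set V} (hX : #X ≤ ν) :
    ∃ B' : Set V, B ⊆ B' ∧ IsSaturated k ν B' ∧ X ⊆ closedSpan (k := k) B' := by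
  obtain ⟨S, hBXS, hSν, hS⟩ :=
    exists_saturated_superset hν hfree (mk_union_le_of_le hν hB.mk_le hX)
  have hBS : B ⊆ S := Set.subset_union_left.trans hBXS
  obtain ⟨I, φ, hφ⟩ := hB.isRelSubfree S hSν
  rw [Set.union_eq_self_of_subset_left hBS] at hφ
  obtain ⟨B', hBB', hB', h1, h2⟩ :=
    hφ.exists_extend hk hB.orthonormal (subset_closedSpan B) le_rfl
  have heq : closedSpan (k := k) B' = closedSpan (k := k) S :=
    le_antisymm (closedSpan_le_closedSpan h1) h2
  refine ⟨B', hBB', ⟨hB', hB'.mk_le hν heq hSν, fun Y hY => ?_⟩, ?_⟩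
  · have hunion : closedSpan (k := k) (B' ∪ Y) = closedSpan (k := k) (S ∪ Y) := by
      refine le_antisymm
        (closedSpan_le_closedSpan (Set.union_subset (h1.trans (closedSpan_mono
          Set.subset_union_left)) (Set.subset_union_right.trans (subset_closedSpan _))))
        (closedSpan_le_closedSpan (Set.union_subset ((subset_closedSpan S).trans (h2.trans
          (closedSpan_mono Set.subset_union_left)))
          (Set.subset_union_right.trans (subset_closedSpan _))))
    rw [heq, hunion]
    exact hS Y hY
  · exact (Set.subset_union_right.trans hBXS).trans ((subset_closedSpan S).trans h2)

/-- Singular compactness for Banach spaces. -/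
theorem isFree_of_isAlmostFree_of_isSingular [IsUltrametricDist k] (hk : ∃ c : k, 1 < ‖c‖)
    (hcard : #V = rank k V) (hω : ℵ₀ < rank k V) (hsing : (rank k V).IsSingular)
    (h : IsAlmostFree k V) : IsFree k V := by
  obtain ⟨e⟩ : Nonempty (V ≃ (rank k V).ord.ToType) := by
    rw [← Cardinal.eq, mk_ord_toType, hcard]
  obtain ⟨ι, hι, hιcard⟩ := Order.exists_cof_eq (rank k V).ord.ToType
  rw [Ordinal.cof_toType] at hιcard
  have hιlt : #ι < rank k V := hιcard ▸ hsing.cof_ord_lt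
  -- Including #ι keeps unions over ι of sets of size ν i within ν i.
  let ν : ι → Cardinal.{v} := fun i => max ℵ₀ (max #ι #(Set.Iic i.1))
  have hν : ∀ i, ℵ₀ ≤ ν i := fun i => le_max_left _ _
  have hιν : ∀ i, #ι ≤ ν i := fun i => (le_max_left _ _).trans (le_max_right _ _)
  have hνmono : Monotone ν := fun i j hij => max_le_max le_rfl (max_le_max le_rfl
    (mk_le_mk_of_subset (Set.Iic_subset_Iic.2 hij)))
  have hνlt : ∀ i, ν i < rank k V := fun i =>
    max_lt hω (max_lt hιlt (mk_Iic_toType_lt hω.le i.1))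
  have hfree : ∀ i, ∀ S : Set V, #S ≤ Order.succ (ν i) → IsFree k (closedSpan (k := k) S) :=
    fun i S hS => h S (hS.trans_lt (hsing.isSuccLimit.succ_lt (hνlt i)))
  let Y : ι → Set V := fun i => e ⁻¹' Set.Iic i.1
  have hY : ∀ i, #(Y i) ≤ ν i := fun i => (mk_preimage_of_injective _ _ e.injective).trans
    ((le_max_right _ _).trans (le_max_right _ _))
  let F := ∀ i : ι, {B : Set V // IsSaturated k (ν i) B}
  -- The i-th set must absorb its share of V, the sets of smaller index, and the supports of its own
  -- elements in every other set. The supports give the splitting in the limit.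
  let X : F → ι → Set V := fun f i =>
    Y i ∪ ((⋃ j ∈ Set.Iio i, (f j).1) ∪ ⋃ j ∈ Set.univ, ⋃ b ∈ (f i).1, spanSupport k (f j).1 b)
  have hX : ∀ f i, #(X f i) ≤ ν i := by
    intro f i
    refine mk_union_le_of_le (hν i) (hY i) (mk_union_le_of_le (hν i) ?_ ?_)
    · exact mk_biUnion_le_of_forall_le (hν i) ((mk_set_le _).trans (hιν i))
        fun j hj => (f j).2.mk_le.trans (hνmono (le_of_lt hj))
    · exact mk_biUnion_le_of_forall_le (hν i) ((mk_set_le _).trans (hιν i)) fun j _ =>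
        mk_biUnion_le_of_forall_le (hν i) (f i).2.mk_le fun b _ => mk_spanSupport_le (hν i) _ b
  have hstep : ∀ f : F, ∃ f' : F, ∀ i, (f i).1 ⊆ (f' i).1 ∧
      X f i ⊆ closedSpan (k := k) (f' i).1 := by
    intro f
    choose f' h1 h2 h3 using fun i => (f i).2.exists_extend hk (hν i) (hfree i) (hX f i)
    exact ⟨fun i => ⟨f' i, h2 i⟩, fun i => ⟨h1 i, h3 i⟩⟩
  choose next hnext hXnext using hstep
  let G : ℕ → F := fun n => Nat.rec (fun i => ⟨∅, isSaturated_empty (hfree i)⟩) (fun _ => next) n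
  have hGmono : ∀ i, Monotone fun n => (G n i).1 := fun i =>
    monotone_nat_of_le_succ fun n => hnext (G n) i
  have hXG : ∀ n i, X (G n) i ⊆ closedSpan (k := k) (G (n + 1) i).1 := fun n i =>
    hXnext (G n) i
  have hGle : ∀ n i, closedSpan (k := k) (G n i).1 ≤ closedSpan (k := k) (⋃ n, (G n i).1) :=
    fun n i => closedSpan_mono (Set.subset_iUnion (fun n => (G n i).1) n)
  obtain ⟨D, hD, hBD⟩ := exists_orthonormal_of_filtration (k := k)
    (B := fun i : ι => ⋃ n, (G n i).1) (fun i => by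
      rw [← Set.sUnion_range]
      refine isOrthonormalSet_sUnion ?_ ?_
      · rw [directedOn_range]
        exact (hGmono i).directed_le
      · rintro _ ⟨n, rfl⟩
        exact (G n i).2.orthonormal) (by
      intro i j hij b hb
      obtain ⟨n, hn⟩ := Set.mem_iUnion.1 hb
      have h1 : b ∈ closedSpan (k := k) (G (n + 1) j).1 :=
        hXG n j (Or.inr (Or.inl (Set.mem_biUnion hij hn)))
      have h2 : spanSupport k (G (n + 1) j).1 b ⊆ X (G (n + 1)) i := fun x hx =>
        Or.inr (Or.inr (Set.mem_biUnion (Set.mem_univ j)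
          (Set.mem_biUnion (hGmono i (Nat.le_succ n) hn) hx)))
      refine closedSpan_mono (Set.subset_inter ?_ ?_) (mem_closedSpan_spanSupport h1)
      · exact (spanSupport_subset _ b).trans (Set.subset_iUnion (fun n => (G n j).1) (n + 1))
      · exact h2.trans ((hXG (n + 1) i).trans (hGle (n + 2) i)))
  refine isFree_iff.2 ⟨D, hD, eq_top_iff.2 fun x _ => ?_⟩
  obtain ⟨i, hi, hxi⟩ := hι (e x)
  have hx : x ∈ closedSpan (k := k) (G 1 ⟨i, hi⟩).1 := hXG 0 ⟨i, hi⟩ (Or.inl hxi)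
  exact closedSpan_le_closedSpan (hBD ⟨i, hi⟩) (hGle 1 ⟨i, hi⟩ hx)

end Singular

theorem isFree_iff_isAlmostFree (k : Type u) [NormedField k] [IsUltrametricDist k]
    [CompleteSpace k] (V : Type v) [NormedAddCommGroup V] [NormedSpace k V]
    [IsUltrametricDist V] [CompleteSpace V] (hcard : #V = rank k V)
    (hcompact : IsStronglyCompactCard
      (Cardinal.lift.{v} (lambdaCard k)) (Cardinal.lift.{u} (rank k V))) :
    IsFree k V ↔ IsAlmostFree k V := by
  -- The singular and trivially valued cases use strong compactness only through this.
  have hω : ℵ₀ < rank k V := by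
    have h1 : ℵ₀ < lambdaCard k := Order.lt_succ_of_le (le_max_right _ _)
    have h2 := (Cardinal.lift_lt.{u, v}.2 h1).trans_le hcompact.1
    rwa [Cardinal.lift_aleph0, Cardinal.aleph0_lt_lift] at h2
  by_cases hk : ∃ c : k, 1 < ‖c‖
  · refine ⟨fun h S _ => h.closedSpan hk S, fun h => ?_⟩
    rcases isRegular_or_isSingular hω.le with hreg | hsing
    · exact isFree_of_isAlmostFree_of_isRegular hk hcard hcompact hreg h
    · exact isFree_of_isAlmostFree_of_isSingular hk hcard hω hsing h
  · push Not at hk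
    exact isFree_iff_isAlmostFree_of_trivial hk (Cardinal.one_lt_aleph0.trans hω)

end UltraBanach

theorem theorem5p1 (k : Type u) [NormedField k] [IsUltrametricDist k] [CompleteSpace k]
    (V : Type v) [NormedAddCommGroup V] [NormedSpace k V] [IsUltrametricDist V] [CompleteSpace V]
    (hcard : #V = UltraBanach.rank k V)
    (hcompact : UltraBanach.IsStronglyCompactCard
      (Cardinal.lift.{v} (UltraBanach.lambdaCard k)) (Cardinal.lift.{u} (UltraBanach.rank k V))) :
    UltraBanach.IsFree k V ↔ UltraBanach.IsAlmostFree k V :=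
  UltraBanach.isFree_iff_isAlmostFree k V hcard hcompact
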